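/- Let $H$ be an infinite-dimensional complex Hilbert space, let $B(H)$ be the set of bounded linear operators on $H$, and let $B_+(H)$ be the cone of positive operators, i.e. of those $A\in B(H)$ with $\langle Ax,x\rangle\ge 0$ for all $x\in H$, ordered by $A\le B$ iff $B-A\in B_+(H)$. For $A,B\in B_+(H)$: - $A$ and $B$ are singular, $A\perp B$, if the only $C\in B_+(H)$ with $C\le A$ and $C\le B$ is $C=0$; - $A$ is $B$-absolutely continuous, $A\ll B$, if there is an increasing sequence $C_1\le C_2\le\cdots$ in $B_+(H)$ that converges to $A$ in the strong operator topology and such that for every $n$ there is a real $c_n\ge 0$ with $C_n\le c_nB$. For a bounded linear or conjugate-linear operator $T$ on $H$, $T^*$ denotes its adjoint; for conjugate-linear $T$ it is the bounded conjugate-linear operator with $\langle Tx,y\rangle=\overline{\langle x,T^*y\rangle}$ for all $x,y\in H$. Let $\varphi:B_+(H)\to B_+(H)$ be a bijection. Then the following four statements are equivalent: (i) for all $A,B\in B_+(H)$: $A\ll B$ if and only if $\varphi(A)\ll\varphi(B)$; (ii) for all $A,B\in B_+(H)$: $A\perp B$ if and only if $\varphi(A)\perp\varphi(B)$; (iii)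 there is a bounded invertible operator $T:H\to H$, linear or conjugate-linear, such that $\operatorname{ran}\varphi(A)^{1/2}=\operatorname{ran}TA^{1/2}$ for all $A\in B_+(H)$; (iv) there are a bounded invertible operator $T:H\to H$, linear or conjugate-linear, and a family $\{Z_A : A\in B_+(H)\}$ of invertible positive operators in $B(H)$ such that $\varphi(A)=(TAT^*)^{1/2}Z_A(TAT^*)^{1/2}$ for all $A\in B_+(H)$. -/

import Mathlib

open Filter Topology
open scoped ComplexConjugate InnerProductSpace

noncomputable section

/-- The cone of bounded positive operators on a complex Hilbert space. -/
abbrev PosOp (H : Type*) [NormedAddCommGroup H] [InnerProductSpace ℂ H] [CompleteSpace H] :=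
  {A : H →L[ℂ] H // A.IsPositive}

section Relations

variable {H : Type*} [NormedAddCommGroup H] [InnerProductSpace ℂ H] [CompleteSpace H]

/-- `A` and `B` are singular: the only positive operator below both of them is `0`. -/
def Singular (A B : PosOp H) : Prop :=
  ∀ C : PosOp H, C ≤ A → C ≤ B → (C : H →L[ℂ] H) = 0

/-- `A` is `B`-dominated: `A ≤ c B` for some real `c ≥ 0`. -/
def Dominated (A B : PosOp H) : Prop :=
  ∃ c : ℝ, 0 ≤ c ∧ (A : H →L[ℂ] H) ≤ c • (B : H →L[ℂ] H)

/-- `A` is `B`-absolutely continuous: `A` is the limit, in the strong operator topology, of a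
monotone increasing sequence of `B`-dominated positive operators. -/
def AbsCont (A B : PosOp H) : Prop :=
  ∃ C : ℕ → PosOp H, Monotone C ∧ (∀ n, Dominated (C n) B) ∧
    ∀ x : H, Tendsto (fun n => (C n : H →L[ℂ] H) x) atTop (𝓝 ((A : H →L[ℂ] H) x))

/-- The positive square root of a bounded positive operator. -/
abbrev opSqrt (A : H →L[ℂ] H) : H →L[ℂ] H := CFC.sqrt A

/-- The adjoint of a bounded conjugate-linear operator `T`: the bounded conjugate-linear operator
`T*` with `⟪T* y, x⟫ = ⟪T x, y⟫` for all `x`, `y`. -/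
def conjAdjoint (T : H →L⋆[ℂ] H) : H →L⋆[ℂ] H :=
  ((InnerProductSpace.toDual ℂ H).symm.toContinuousLinearEquiv :
      (H →L[ℂ] ℂ) →L⋆[ℂ] H).comp
    ((innerSL ℂ : H →L⋆[ℂ] H →L[ℂ] ℂ).comp T).flip

theorem conjAdjoint_inner (T : H →L⋆[ℂ] H) (x y : H) :
    ⟪conjAdjoint T y, x⟫_ℂ = ⟪T x, y⟫_ℂ := by
  simp [conjAdjoint]

/-- The linear operator `T A T*` for a bounded linear `T`. -/
def conjugateLin (T : H →L[ℂ] H) (A : H →L[ℂ] H) : H →L[ℂ] H :=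
  T ∘L A ∘L ContinuousLinearMap.adjoint T

/-- The linear operator `T A T*` for a bounded conjugate-linear `T`. -/
def conjugateConj (T : H →L⋆[ℂ] H) (A : H →L[ℂ] H) : H →L[ℂ] H :=
  T.comp (A.comp (conjAdjoint T))

end Relations

end

/- Everything is encoded in the operator ranges `ran A^{1/2}`, the root ranges. By Douglas' lemma,
domination is inclusion of root ranges, hence singularity is the triviality of their intersection.
Moreover `A ≪ B` iff `(A^{1/2})⁻¹(ran B^{1/2})` is dense, the parallel sums of `A` and `n² B` being
an approximating sequence. When two root ranges meet in finite dimension, that preimage is closed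
and `≪` is inclusion too, so a map preserving `≪` or `⟂` preserves inclusion of root ranges.

On one-dimensional root ranges such a map is a collineation, and the fundamental theorem of
projective geometry gives a semilinear bijection `T`, over a field automorphism `σ`, that carries
the root range of every `A` to that of `φ A`. The preimages of closed hyperplanes under `T` are then
root ranges; a hyperplane that is an operator range is closed, so the functionals `σ⁻¹ ⟪y, T x⟫` of
`x` are bounded. In infinite dimension this forces `σ` to be continuous, hence the identity or
conjugation, and `T` to be bounded. Finally, two root ranges agree iff the operators differ by an
invertible positive `Z` in the middle, `B = A^{1/2} Z A^{1/2}`. -/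

noncomputable section

section Pullback

variable {𝕜 E F G : Type*} [NontriviallyNormedField 𝕜]
  [NormedAddCommGroup E] [NormedSpace 𝕜 E] [NormedAddCommGroup F] [NormedSpace 𝕜 F]
  [NormedAddCommGroup G] [NormedSpace 𝕜 G]

/-- The pullback of two operators with a common target: the pairs `(x, y)` with `R x = S y`. -/
def operatorPullback (R : E →L[𝕜] G) (S : F →L[𝕜] G) : Submodule 𝕜 (E × F) :=
  (R.coprod (-S)).ker

theorem mem_operatorPullback {R : E →L[𝕜] G} {S : F →L[𝕜] G} {p : E × F} :
    p ∈ operatorPullback R S ↔ R p.1 = S p.2 := by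
  simp [operatorPullback, ← sub_eq_add_neg, sub_eq_zero]

variable [CompleteSpace E] [CompleteSpace F]

theorem completeSpace_operatorPullback (R : E →L[𝕜] G) (S : F →L[𝕜] G) :
    CompleteSpace (operatorPullback R S) :=
  (R.coprod (-S)).isClosed_ker.completeSpace_coe

theorem exists_norm_le_of_range_le {R : E →L[𝕜] G} {S : F →L[𝕜] G} (h : R.range ≤ S.range) :
    ∃ C, 0 < C ∧ ∀ x, ∃ y, S y = R x ∧ ‖y‖ ≤ C * ‖x‖ := by
  have := completeSpace_operatorPullback R S
  obtain ⟨C, hC, hbound⟩ :=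
    (ContinuousLinearMap.fst 𝕜 E F ∘L (operatorPullback R S).subtypeL).exists_preimage_norm_le
      fun x => by
        obtain ⟨y, hy⟩ := h ⟨x, rfl⟩
        exact ⟨⟨(x, y), mem_operatorPullback.2 hy.symm⟩, rfl⟩
  refine ⟨C, hC, fun x => ?_⟩
  obtain ⟨p, rfl, hp⟩ := hbound x
  exact ⟨p.1.2, (mem_operatorPullback.1 p.2).symm, (norm_snd_le p.1).trans hp⟩

theorem dense_preimage_iff_of_range_eq {R : E →L[𝕜] G} {S : F →L[𝕜] G} (h : R.range = S.range)
    (M : Set G) : Dense (R ⁻¹' M) ↔ Dense (S ⁻¹' M) := by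
  have := completeSpace_operatorPullback R S
  let fst := ContinuousLinearMap.fst 𝕜 E F ∘L (operatorPullback R S).subtypeL
  let snd := ContinuousLinearMap.snd 𝕜 E F ∘L (operatorPullback R S).subtypeL
  have hfst : Function.Surjective fst := fun x => by
    obtain ⟨y, hy⟩ := h.le ⟨x, rfl⟩
    exact ⟨⟨(x, y), mem_operatorPullback.2 hy.symm⟩, rfl⟩
  have hsnd : Function.Surjective snd := fun y => by
    obtain ⟨x, hx⟩ := h.ge ⟨y, rfl⟩
    exact ⟨⟨(x, y), mem_operatorPullback.2 hx⟩, rfl⟩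
  have hpre : fst ⁻¹' (R ⁻¹' M) = snd ⁻¹' (S ⁻¹' M) := Set.ext fun p => by
    change R p.1.1 ∈ M ↔ S p.1.2 ∈ M
    rw [mem_operatorPullback.1 p.2]
  rw [← IsOpenQuotientMap.dense_preimage_iff ⟨hfst, fst.continuous, fst.isOpenMap hfst⟩, hpre,
    IsOpenQuotientMap.dense_preimage_iff ⟨hsnd, snd.continuous, snd.isOpenMap hsnd⟩]

end Pullback

section Douglas

variable {𝕜 E F G : Type*} [RCLike 𝕜] [NormedAddCommGroup E] [InnerProductSpace 𝕜 E]
  [NormedAddCommGroup F] [InnerProductSpace 𝕜 F] [CompleteSpace F]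
  [NormedAddCommGroup G] [InnerProductSpace 𝕜 G] [CompleteSpace G]

theorem exists_comp_eq_of_norm_le {R : E →L[𝕜] F} {S : E →L[𝕜] G} {a : ℝ} (ha : 0 ≤ a)
    (h : ∀ x, ‖R x‖ ≤ a * ‖S x‖) : ∃ V : G →L[𝕜] F, V ∘L S = R ∧ ‖V‖ ≤ a := by
  let e : E →ₗ[𝕜] S.range.topologicalClosure :=
    Submodule.inclusion S.range.le_topologicalClosure ∘ₗ S.rangeRestrict
  have he : DenseRange e := by
    refine (denseRange_inclusion_iff subset_closure).2 le_rfl |>.comp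
      S.toLinearMap.surjective_rangeRestrict.denseRange ?_
    exact continuous_inclusion subset_closure
  refine ⟨R.toLinearMap.extendOfNorm e ∘L S.range.topologicalClosure.orthogonalProjectionOnto,
    ContinuousLinearMap.ext fun x => ?_, ?_⟩
  · have hx : S.range.topologicalClosure.orthogonalProjectionOnto (S x) = e x :=
      Submodule.orthogonalProjectionOnto_mem_subspace_eq_self (e x)
    exact (congrArg _ hx).trans (LinearMap.extendOfNorm_eq he ⟨a, h⟩ x)
  · refine (ContinuousLinearMap.opNorm_comp_le _ _).trans ?_
    exact (mul_le_mul (LinearMap.opNorm_extendOfNorm_le he ha h)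
      (Submodule.orthogonalProjectionOnto_norm_le _) (norm_nonneg _) ha).trans_eq (mul_one a)

variable [CompleteSpace E]

open ContinuousLinearMap in
/-- Douglas' lemma. -/
theorem range_adjoint_le_iff {R : E →L[𝕜] F} {S : E →L[𝕜] G} :
    (adjoint R).range ≤ (adjoint S).range ↔ ∃ a, 0 ≤ a ∧ ∀ x, ‖R x‖ ≤ a * ‖S x‖ := by
  constructor
  · intro h
    obtain ⟨C, hC, hbound⟩ := exists_norm_le_of_range_le h
    refine ⟨C, hC.le, fun x => ?_⟩
    obtain ⟨z, hz, hzx⟩ := hbound (R x)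
    have hsq : ‖R x‖ ^ 2 ≤ C * ‖S x‖ * ‖R x‖ := by
      calc ‖R x‖ ^ 2 = ‖⟪z, S x⟫_𝕜‖ := by
            rw [← adjoint_inner_left, hz, adjoint_inner_left, inner_self_eq_norm_sq_to_K]
            simp
        _ ≤ ‖z‖ * ‖S x‖ := norm_inner_le_norm _ _
        _ ≤ C * ‖R x‖ * ‖S x‖ := by gcongr
        _ = C * ‖S x‖ * ‖R x‖ := by ring
    rcases (norm_nonneg (R x)).eq_or_lt with h0 | h0
    · rw [← h0]
      positivity
    · exact le_of_mul_le_mul_right (by rwa [sq] at hsq) h0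
  · rintro ⟨a, ha, h⟩
    obtain ⟨V, rfl, -⟩ := exists_comp_eq_of_norm_le ha h
    rw [adjoint_comp]
    exact LinearMap.range_comp_le_range _ _

end Douglas

section SquareRoot

variable {H : Type*} [NormedAddCommGroup H] [InnerProductSpace ℂ H] [CompleteSpace H]

theorem isPositive_opSqrt (A : H →L[ℂ] H) : (opSqrt A).IsPositive :=
  (ContinuousLinearMap.nonneg_iff_isPositive _).1 (CFC.sqrt_nonneg A)

theorem adjoint_opSqrt (A : H →L[ℂ] H) : ContinuousLinearMap.adjoint (opSqrt A) = opSqrt A :=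
  (isPositive_opSqrt A).isSelfAdjoint.adjoint_eq

theorem inner_opSqrt_left (A : H →L[ℂ] H) (x y : H) :
    ⟪opSqrt A x, y⟫_ℂ = ⟪x, opSqrt A y⟫_ℂ :=
  (isPositive_opSqrt A).inner_left_eq_inner_right x y

theorem opSqrt_opSqrt {A : H →L[ℂ] H} (hA : A.IsPositive) (x : H) :
    opSqrt A (opSqrt A x) = A x :=
  DFunLike.congr_fun
    (CFC.sqrt_mul_sqrt_self A ((ContinuousLinearMap.nonneg_iff_isPositive _).2 hA)) x

theorem norm_opSqrt_sq {A : H →L[ℂ] H} (hA : A.IsPositive) (x : H) :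
    ‖opSqrt A x‖ ^ 2 = (⟪A x, x⟫_ℂ).re := by
  rw [← opSqrt_opSqrt hA, inner_opSqrt_left, inner_self_eq_norm_sq_to_K]
  norm_cast

theorem norm_opSqrt_eq_iff {A : H →L[ℂ] H} (hA : A.IsPositive) {x : H} {r : ℝ} (hr : 0 ≤ r) :
    ‖opSqrt A x‖ = r ↔ (⟪A x, x⟫_ℂ).re = r ^ 2 := by
  rw [← norm_opSqrt_sq hA, sq_eq_sq₀ (norm_nonneg _) hr]

theorem posOp_le_iff_norm_le {A B : PosOp H} :
    A ≤ B ↔ ∀ x, ‖opSqrt A.1 x‖ ≤ ‖opSqrt B.1 x‖ := by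
  rw [← Subtype.coe_le_coe, ContinuousLinearMap.le_def, ContinuousLinearMap.isPositive_def,
    and_iff_right (by simpa using B.2.isSymmetric.sub A.2.isSymmetric)]
  refine forall_congr' fun x => ?_
  rw [← sq_le_sq₀ (norm_nonneg _) (norm_nonneg _), norm_opSqrt_sq A.2, norm_opSqrt_sq B.2,
    ContinuousLinearMap.reApplyInnerSelf_apply, sub_apply, inner_sub_left, map_sub, sub_nonneg]
  rfl

/-- The positive operator `c A`. -/
def posSMul {c : ℝ} (hc : 0 ≤ c) (A : PosOp H) : PosOp H :=
  ⟨c • A.1, (ContinuousLinearMap.nonneg_iff_isPositive _).1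
    (smul_nonneg hc ((ContinuousLinearMap.nonneg_iff_isPositive _).2 A.2))⟩

theorem norm_opSqrt_posSMul {c : ℝ} (hc : 0 ≤ c) (A : PosOp H) (x : H) :
    ‖opSqrt (posSMul hc A).1 x‖ = √c * ‖opSqrt A.1 x‖ := by
  rw [norm_opSqrt_eq_iff (posSMul hc A).2 (by positivity), mul_pow, Real.sq_sqrt hc,
    norm_opSqrt_sq A.2]
  change (⟪(c • A.1) x, x⟫_ℂ).re = _
  rw [smul_apply, ← Complex.coe_smul, inner_smul_left, Complex.conj_ofReal, Complex.re_ofReal_mul]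

theorem dominated_iff_norm_le {A B : PosOp H} :
    Dominated A B ↔ ∃ a, 0 ≤ a ∧ ∀ x, ‖opSqrt A.1 x‖ ≤ a * ‖opSqrt B.1 x‖ := by
  constructor
  · rintro ⟨c, hc, h⟩
    refine ⟨√c, Real.sqrt_nonneg c, fun x => ?_⟩
    exact (posOp_le_iff_norm_le (B := posSMul hc B).1 h x).trans_eq (norm_opSqrt_posSMul hc B x)
  · rintro ⟨a, ha, h⟩
    refine ⟨a ^ 2, sq_nonneg a, (posOp_le_iff_norm_le (B := posSMul (sq_nonneg a) B)).2 fun x => ?_⟩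
    rw [norm_opSqrt_posSMul, Real.sqrt_sq ha]
    exact h x

end SquareRoot

section RootRange

variable {H : Type*} [NormedAddCommGroup H] [InnerProductSpace ℂ H] [CompleteSpace H]

/-- The range of the square root of a positive operator. -/
def rootRange (A : PosOp H) : Submodule ℂ H := (opSqrt A.1).range

theorem rootRange_le_iff_norm_le {A B : PosOp H} :
    rootRange A ≤ rootRange B ↔ ∃ a, 0 ≤ a ∧ ∀ x, ‖opSqrt A.1 x‖ ≤ a * ‖opSqrt B.1 x‖ := by
  rw [← range_adjoint_le_iff, adjoint_opSqrt, adjoint_opSqrt]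
  rfl

theorem dominated_iff_rootRange_le {A B : PosOp H} :
    Dominated A B ↔ rootRange A ≤ rootRange B :=
  dominated_iff_norm_le.trans rootRange_le_iff_norm_le.symm

theorem rootRange_mono : Monotone (rootRange : PosOp H → Submodule ℂ H) := fun A B h =>
  dominated_iff_rootRange_le.1 ⟨1, zero_le_one, by simpa using h⟩

theorem mem_rootRange_iff {A : PosOp H} {y : H} :
    y ∈ rootRange A ↔ ∃ c, 0 ≤ c ∧ ∀ x, ‖⟪y, x⟫_ℂ‖ ≤ c * ‖opSqrt A.1 x‖ := by
  have h := range_adjoint_le_iff (R := innerSL ℂ y) (S := opSqrt A.1)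
  rwa [adjoint_opSqrt, ContinuousLinearMap.adjoint_innerSL_apply,
    ContinuousLinearMap.toLinearMap_toSpanSingleton, LinearMap.range_toSpanSingleton,
    Submodule.span_singleton_le_iff_mem] at h

theorem rootRange_eq_bot_iff {A : PosOp H} : rootRange A = ⊥ ↔ A.1 = 0 := by
  constructor
  · intro h
    ext x
    have hx : opSqrt A.1 (opSqrt A.1 x) ∈ rootRange A := ⟨_, rfl⟩
    rwa [h, Submodule.mem_bot, opSqrt_opSqrt A.2] at hx
  · intro h
    rw [rootRange, h, opSqrt, CFC.sqrt_zero]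
    exact LinearMap.range_zero

/-- The orthogonal projection onto a complete subspace as a positive operator. -/
def projOp (K : Submodule ℂ H) [K.HasOrthogonalProjection] : PosOp H :=
  ⟨K.starProjection, .of_isStarProjection isStarProjection_starProjection⟩

@[simp] theorem rootRange_projOp (K : Submodule ℂ H) [K.HasOrthogonalProjection] :
    rootRange (projOp K) = K := by
  have hsqrt : opSqrt (projOp K).1 = K.starProjection :=
    CFC.sqrt_unique K.isIdempotentElem_starProjection
      ((ContinuousLinearMap.nonneg_iff_isPositive _).2 (projOp K).2)
  rw [rootRange, hsqrt]
  exact K.range_starProjection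

theorem Singular.eq_zero_of_dominated {A B C : PosOp H} (h : Singular A B) (hA : Dominated C A)
    (hB : Dominated C B) : C.1 = 0 := by
  obtain ⟨a, ha, hCA⟩ := dominated_iff_norm_le.1 hA
  obtain ⟨b, hb, hCB⟩ := dominated_iff_norm_le.1 hB
  have hc : 0 < (a + b + 1)⁻¹ := by positivity
  have hle : ∀ (D : PosOp H) (d : ℝ), d ≤ a + b + 1 →
      (∀ x, ‖opSqrt C.1 x‖ ≤ d * ‖opSqrt D.1 x‖) → posSMul (sq_nonneg (a + b + 1)⁻¹) C ≤ D := by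
    refine fun D d hd hCD => posOp_le_iff_norm_le.2 fun x => ?_
    rw [norm_opSqrt_posSMul, Real.sqrt_sq hc.le, inv_mul_le_iff₀ (by positivity)]
    exact (hCD x).trans (by gcongr)
  have h0 := h _ (hle A a (by linarith) hCA) (hle B b (by linarith) hCB)
  exact (smul_eq_zero.1 h0).resolve_left (pow_pos hc 2).ne'

theorem singular_iff_disjoint {A B : PosOp H} :
    Singular A B ↔ Disjoint (rootRange A) (rootRange B) := by
  constructor
  · refine fun h => Submodule.disjoint_def.2 fun y hyA hyB => ?_
    have hdom : ∀ D : PosOp H, y ∈ rootRange D → Dominated (projOp (ℂ ∙ y)) D := fun D hD => by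
      rwa [dominated_iff_rootRange_le, rootRange_projOp, Submodule.span_singleton_le_iff_mem]
    have h0 := rootRange_eq_bot_iff.2 (h.eq_zero_of_dominated (hdom A hyA) (hdom B hyB))
    rwa [rootRange_projOp, Submodule.span_singleton_eq_bot] at h0
  · exact fun h C hA hB => rootRange_eq_bot_iff.1 <|
      le_bot_iff.1 (h (rootRange_mono hA) (rootRange_mono hB))

end RootRange

section Factorization

variable {H : Type*} [NormedAddCommGroup H] [InnerProductSpace ℂ H] [CompleteSpace H]

open ContinuousLinearMap in
theorem rootRange_eq_range_adjoint {H' : Type*} [NormedAddCommGroup H'] [InnerProductSpace ℂ H']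
    [CompleteSpace H'] {A : PosOp H} {R : H →L[ℂ] H'} (h : A.1 = adjoint R ∘L R) :
    rootRange A = (adjoint R).range := by
  have hnorm : ∀ x, ‖opSqrt A.1 x‖ = ‖R x‖ := fun x => by
    rw [norm_opSqrt_eq_iff A.2 (norm_nonneg _), h, apply_norm_sq_eq_inner_adjoint_left]
    rfl
  rw [rootRange, ← adjoint_opSqrt]
  exact le_antisymm (range_adjoint_le_iff.2 ⟨1, zero_le_one, fun x => by simp [hnorm]⟩)
    (range_adjoint_le_iff.2 ⟨1, zero_le_one, fun x => by simp [hnorm]⟩)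

open ContinuousLinearMap in
theorem isUnit_adjoint_comp_self_add {𝕜 E F G : Type*} [RCLike 𝕜] [NormedAddCommGroup E]
    [InnerProductSpace 𝕜 E] [CompleteSpace E] [NormedAddCommGroup F] [InnerProductSpace 𝕜 F]
    [CompleteSpace F] [NormedAddCommGroup G] [InnerProductSpace 𝕜 G] [CompleteSpace G]
    {V : E →L[𝕜] F} {W : F →L[𝕜] E} {Q : E →L[𝕜] G} {U : G →L[𝕜] E}
    (h : W ∘L V + U ∘L Q = 1) : IsUnit (adjoint V ∘L V + adjoint Q ∘L Q) := by
  set a := ‖W‖ + ‖U‖ + 1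
  have : 0 < a := by positivity
  have hbound : ∀ x, ‖x‖ ≤ a * (‖V x‖ + ‖Q x‖) := fun x => by
    calc ‖x‖ = ‖W (V x) + U (Q x)‖ := congrArg norm (DFunLike.congr_fun h x).symm
      _ ≤ ‖W‖ * ‖V x‖ + ‖U‖ * ‖Q x‖ := norm_add_le_of_le (W.le_opNorm _) (U.le_opNorm _)
      _ ≤ a * ‖V x‖ + a * ‖Q x‖ := by
        gcongr <;> linarith [norm_nonneg W, norm_nonneg U]
      _ = a * (‖V x‖ + ‖Q x‖) := by ring
  refine isUnit_of_forall_le_norm_inner_map _ (c := ⟨(2 * a ^ 2)⁻¹, by positivity⟩)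
    (show 0 < (2 * a ^ 2)⁻¹ by positivity) fun x => ?_
  refine le_trans ?_ (RCLike.re_le_norm _)
  rw [add_apply, inner_add_left, map_add, ← apply_norm_sq_eq_inner_adjoint_left,
    ← apply_norm_sq_eq_inner_adjoint_left]
  change ‖x‖ ^ 2 * (2 * a ^ 2)⁻¹ ≤ _
  rw [mul_inv_le_iff₀ (by positivity)]
  calc ‖x‖ ^ 2 ≤ (a * (‖V x‖ + ‖Q x‖)) ^ 2 := by gcongr; exact hbound x
    _ = a ^ 2 * (‖V x‖ + ‖Q x‖) ^ 2 := mul_pow _ _ _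
    _ ≤ a ^ 2 * (2 * (‖V x‖ ^ 2 + ‖Q x‖ ^ 2)) := by gcongr; exact add_sq_le
    _ = _ := by ring

open ContinuousLinearMap in
theorem exists_isUnit_of_rootRange_eq {A B : PosOp H} (h : rootRange B = rootRange A) :
    ∃ Z : PosOp H, IsUnit Z.1 ∧ B.1 = opSqrt A.1 ∘L Z.1 ∘L opSqrt A.1 := by
  obtain ⟨a, ha, hBA⟩ := rootRange_le_iff_norm_le.1 h.le
  obtain ⟨b, hb, hAB⟩ := rootRange_le_iff_norm_le.1 h.ge
  obtain ⟨V, hV, -⟩ := exists_comp_eq_of_norm_le ha hBA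
  obtain ⟨W, hW, -⟩ := exists_comp_eq_of_norm_le hb hAB
  let Q := (rootRange A)ᗮ.starProjection
  have hQ : Q ∘L opSqrt A.1 = 0 := ContinuousLinearMap.ext fun x =>
    (rootRange A)ᗮ.starProjection_apply_eq_zero_iff.2
      ((rootRange A).le_orthogonal_orthogonal ⟨x, rfl⟩)
  have hWV : Set.EqOn (W ∘L V) id (closure (rootRange A)) := by
    refine Set.EqOn.closure ?_ (W ∘L V).continuous continuous_id
    rintro _ ⟨y, rfl⟩
    exact (congrArg W (DFunLike.congr_fun hV y)).trans (DFunLike.congr_fun hW y)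
  have hsplit : W ∘L V + (1 - W ∘L V) ∘L Q = 1 := ContinuousLinearMap.ext fun x => by
    have hx : x - Q x ∈ closure (rootRange A : Set H) := by
      rw [← Submodule.topologicalClosure_coe, ← Submodule.orthogonal_orthogonal_eq_closure]
      exact (rootRange A)ᗮ.sub_starProjection_mem_orthogonal x
    have hfix := hWV hx
    rw [map_sub, id_eq] at hfix
    calc (W ∘L V) x + (Q x - (W ∘L V) (Q x)) = (W ∘L V) x - (W ∘L V) (Q x) + Q x := by abel
      _ = x := by rw [hfix, sub_add_cancel]
  refine ⟨⟨adjoint V ∘L V + adjoint Q ∘L Q,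
    (isPositive_adjoint_comp_self V).add (isPositive_adjoint_comp_self Q)⟩,
    isUnit_adjoint_comp_self_add hsplit, ?_⟩
  have hB : opSqrt A.1 ∘L adjoint V ∘L V ∘L opSqrt A.1 = B.1 := by
    rw [hV, ← comp_assoc, ← adjoint_opSqrt A.1, ← adjoint_comp, hV, adjoint_opSqrt]
    exact ContinuousLinearMap.ext (opSqrt_opSqrt B.2)
  rw [add_comp, comp_add, comp_assoc, comp_assoc, hQ, comp_zero, comp_zero, add_zero, hB]

theorem rootRange_eq_of_isUnit {A B Z : PosOp H} (hZ : IsUnit Z.1)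
    (h : B.1 = opSqrt A.1 ∘L Z.1 ∘L opSqrt A.1) : rootRange B = rootRange A := by
  have hunit : IsUnit (opSqrt Z.1) :=
    (CFC.isUnit_sqrt_iff Z.1 ((ContinuousLinearMap.nonneg_iff_isPositive _).2 Z.2)).2 hZ
  have hsurj : Function.Surjective (opSqrt Z.1) :=
    (ContinuousLinearMap.isUnit_iff_bijective.1 hunit).2
  have hadj : ContinuousLinearMap.adjoint (opSqrt Z.1 ∘L opSqrt A.1) =
      opSqrt A.1 ∘L opSqrt Z.1 := by
    rw [ContinuousLinearMap.adjoint_comp, adjoint_opSqrt, adjoint_opSqrt]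
  have hB : B.1 = ContinuousLinearMap.adjoint (opSqrt Z.1 ∘L opSqrt A.1) ∘L
      (opSqrt Z.1 ∘L opSqrt A.1) := by
    rw [hadj, h]
    exact ContinuousLinearMap.ext fun x => congrArg _ (opSqrt_opSqrt Z.2 _).symm
  rw [rootRange_eq_range_adjoint hB, hadj]
  exact LinearMap.range_comp_of_range_eq_top _ (LinearMap.range_eq_top.2 hsurj)

end Factorization

section Congruence

variable {H H' : Type*} [NormedAddCommGroup H] [InnerProductSpace ℂ H] [CompleteSpace H]
  [NormedAddCommGroup H'] [InnerProductSpace ℂ H'] [CompleteSpace H']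

theorem coe_rootRange_eq_image {T : H → H'} {T' : H' → H} (hT : Function.Bijective T)
    (hT' : Function.Surjective T') (hadj : ∀ x y, ‖⟪T x, y⟫_ℂ‖ = ‖⟪x, T' y⟫_ℂ‖)
    {A : PosOp H} {A' : PosOp H'} (h : ∀ z, ‖opSqrt A'.1 z‖ = ‖opSqrt A.1 (T' z)‖) :
    (rootRange A' : Set H') = T '' rootRange A := by
  ext y
  obtain ⟨x, rfl⟩ := hT.2 y
  rw [hT.1.mem_set_image, SetLike.mem_coe, SetLike.mem_coe, mem_rootRange_iff, mem_rootRange_iff]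
  refine exists_congr fun c => and_congr_right fun _ => ?_
  rw [hT'.forall (p := fun z => ‖⟪x, z⟫_ℂ‖ ≤ c * ‖opSqrt A.1 z‖)]
  simp only [hadj, h]

/-- `T A T*` as a positive operator, for linear `T`. -/
def conjugateLinPos (T : H →L[ℂ] H) (A : PosOp H) : PosOp H :=
  ⟨conjugateLin T A.1, A.2.conj_adjoint T⟩

theorem coe_rootRange_conjugateLinPos (T : H →L[ℂ] H) (A : PosOp H) :
    (rootRange (conjugateLinPos T A) : Set H) = T '' rootRange A := by
  have hadj : ContinuousLinearMap.adjoint (opSqrt A.1 ∘L ContinuousLinearMap.adjoint T) =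
      T ∘L opSqrt A.1 := by
    rw [ContinuousLinearMap.adjoint_comp, adjoint_opSqrt, ContinuousLinearMap.adjoint_adjoint]
  rw [rootRange_eq_range_adjoint (R := opSqrt A.1 ∘L ContinuousLinearMap.adjoint T), hadj]
  · exact Set.range_comp T (opSqrt A.1)
  · rw [hadj]
    exact ContinuousLinearMap.ext fun x => congrArg T (opSqrt_opSqrt A.2 _).symm

theorem inner_conjAdjoint_right (T : H →L⋆[ℂ] H) (x y : H) :
    ⟪x, conjAdjoint T y⟫_ℂ = ⟪y, T x⟫_ℂ := by
  rw [← inner_conj_symm, conjAdjoint_inner, inner_conj_symm]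

theorem surjective_conjAdjoint (T : H ≃L⋆[ℂ] H) :
    Function.Surjective (conjAdjoint (T : H →L⋆[ℂ] H)) := fun y =>
  ⟨conjAdjoint (T.symm : H →L⋆[ℂ] H) y, ext_inner_right ℂ fun x => by
    rw [conjAdjoint_inner, inner_conjAdjoint_right]
    simp⟩

theorem inner_conjugateConj (T : H →L⋆[ℂ] H) (A : H →L[ℂ] H) (z : H) :
    ⟪conjugateConj T A z, z⟫_ℂ = ⟪conjAdjoint T z, A (conjAdjoint T z)⟫_ℂ := by
  rw [conjAdjoint_inner]
  rfl

/-- `T A T*` as a positive operator, for conjugate-linear `T`. -/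
def conjugateConjPos (T : H →L⋆[ℂ] H) (A : PosOp H) : PosOp H :=
  ⟨conjugateConj T A.1, by
    refine (ContinuousLinearMap.isPositive_iff_complex _).2 fun z => ?_
    have h := A.2.inner_nonneg_right (conjAdjoint T z)
    rw [← inner_conjugateConj] at h
    obtain ⟨hre, him⟩ := Complex.nonneg_iff.1 h
    exact ⟨Complex.ext rfl him, hre⟩⟩

theorem norm_opSqrt_conjugateConjPos (T : H →L⋆[ℂ] H) (A : PosOp H) (z : H) :
    ‖opSqrt (conjugateConjPos T A).1 z‖ = ‖opSqrt A.1 (conjAdjoint T z)‖ := by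
  rw [norm_opSqrt_eq_iff (conjugateConjPos T A).2 (norm_nonneg _), norm_opSqrt_sq A.2,
    A.2.inner_left_eq_inner_right]
  exact congrArg Complex.re (inner_conjugateConj T A.1 z)

theorem coe_rootRange_conjugateConjPos (T : H ≃L⋆[ℂ] H) (A : PosOp H) :
    (rootRange (conjugateConjPos (T : H →L⋆[ℂ] H) A) : Set H) = T '' rootRange A :=
  coe_rootRange_eq_image T.bijective (surjective_conjAdjoint T)
    (fun x y => (norm_inner_symm _ _).trans
      (congrArg norm (inner_conjAdjoint_right (T : H →L⋆[ℂ] H) x y).symm))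
    (norm_opSqrt_conjugateConjPos _ A)

end Congruence

section ParallelKernel

variable {𝕜 E F G : Type*} [RCLike 𝕜] [NormedAddCommGroup E] [InnerProductSpace 𝕜 E]
  [NormedAddCommGroup F] [InnerProductSpace 𝕜 F] [NormedAddCommGroup G] [InnerProductSpace 𝕜 G]

/-- The operator `x ↦ (S x, R x)` into the Hilbert sum of the targets of `S` and `R`. -/
def hilbertPair (S : E →L[𝕜] G) (R : E →L[𝕜] F) : E →L[𝕜] WithLp 2 (G × F) :=
  (WithLp.prodContinuousLinearEquiv 2 𝕜 G F).symm ∘L S.prod R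

theorem toLp_sub_hilbertPair (S : E →L[𝕜] G) (R : E →L[𝕜] F) (x : E) :
    WithLp.toLp 2 (0, R x) - hilbertPair S R x = WithLp.toLp 2 (-S x, 0) := by
  refine (WithLp.toLp_sub 2 (0, R x) (S x, R x)).symm.trans ?_
  rw [Prod.mk_sub_mk, zero_sub, sub_self]

variable [CompleteSpace F] [CompleteSpace G]

/-- The distance vector from `(0, y)` to the range of `x ↦ (S x, R x)`. -/
def distanceVector (S : E →L[𝕜] G) (R : E →L[𝕜] F) : F →L[𝕜] WithLp 2 (G × F) :=
  (hilbertPair S R).rangeᗮ.starProjection ∘L hilbertPair 0 (.id 𝕜 F)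

theorem distanceVector_apply (S : E →L[𝕜] G) (R : E →L[𝕜] F) (y : F) :
    distanceVector S R y = (hilbertPair S R).rangeᗮ.starProjection (WithLp.toLp 2 (0, y)) := rfl

theorem norm_distanceVector_le (S : E →L[𝕜] G) (R : E →L[𝕜] F) (y : F) :
    ‖distanceVector S R y‖ ≤ ‖y‖ := by
  rw [distanceVector_apply]
  exact (Submodule.norm_starProjection_apply_le _ _).trans_eq (WithLp.norm_toLp_snd 2 G F y)

theorem norm_distanceVector_le_norm_sub (S : E →L[𝕜] G) (R : E →L[𝕜] F) (y : F) (x : E) :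
    ‖distanceVector S R y‖ ≤ ‖WithLp.toLp 2 (0, y) - hilbertPair S R x‖ := by
  have hx : (hilbertPair S R).rangeᗮ.starProjection (hilbertPair S R x) = 0 :=
    (Submodule.starProjection_apply_eq_zero_iff _).2
      (Submodule.le_orthogonal_orthogonal _ ⟨x, rfl⟩)
  rw [distanceVector_apply, ← sub_zero ((hilbertPair S R).rangeᗮ.starProjection _), ← hx, ← map_sub]
  exact Submodule.norm_starProjection_apply_le _ _

theorem norm_distanceVector_apply_le (S : E →L[𝕜] G) (R : E →L[𝕜] F) (x : E) :
    ‖distanceVector S R (R x)‖ ≤ ‖S x‖ := by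
  refine (norm_distanceVector_le_norm_sub S R (R x) x).trans_eq ?_
  rw [toLp_sub_hilbertPair, WithLp.norm_toLp_fst, norm_neg]

theorem norm_distanceVector_mono {S S' : E →L[𝕜] G} (h : ∀ x, ‖S x‖ ≤ ‖S' x‖) (R : E →L[𝕜] F)
    (y : F) : ‖distanceVector S R y‖ ≤ ‖distanceVector S' R y‖ := by
  set u : WithLp 2 (G × F) := WithLp.toLp 2 (0, y)
  have hbound : ∀ w ∈ closure ((hilbertPair S' R).range : Set (WithLp 2 (G × F))),
      ‖distanceVector S R y‖ ≤ ‖u - w‖ := by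
    refine closure_minimal ?_
      (isClosed_le continuous_const (continuous_const.sub continuous_id).norm)
    rintro _ ⟨x, rfl⟩
    refine (norm_distanceVector_le_norm_sub S R y x).trans ?_
    rw [← sq_le_sq₀ (norm_nonneg _) (norm_nonneg _), WithLp.prod_norm_sq_eq_of_L2,
      WithLp.prod_norm_sq_eq_of_L2]
    change ‖0 - S x‖ ^ 2 + ‖y - R x‖ ^ 2 ≤ ‖0 - S' x‖ ^ 2 + ‖y - R x‖ ^ 2
    rw [zero_sub, zero_sub, norm_neg, norm_neg]
    gcongr
    exact h x
  have hmem : u - distanceVector S' R y ∈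
      closure ((hilbertPair S' R).range : Set (WithLp 2 (G × F))) := by
    rw [← Submodule.topologicalClosure_coe, ← Submodule.orthogonal_orthogonal_eq_closure]
    exact Submodule.sub_starProjection_mem_orthogonal _
  exact (hbound _ hmem).trans_eq (by rw [sub_sub_cancel])

/-- The contraction `D` on the target of `R` for which `R* D R` is the parallel sum of `R* R` and
`S* S`; see `inner_parallelKernel`. -/
def parallelKernel (S : E →L[𝕜] G) (R : E →L[𝕜] F) : F →L[𝕜] F :=
  WithLp.sndL 2 𝕜 G F ∘L distanceVector S R

theorem inner_parallelKernel (S : E →L[𝕜] G) (R : E →L[𝕜] F) (y z : F) :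
    ⟪parallelKernel S R y, z⟫_𝕜 = ⟪distanceVector S R y, distanceVector S R z⟫_𝕜 := by
  rw [distanceVector_apply S R z, ← Submodule.inner_starProjection_left_eq_right,
    distanceVector_apply S R y, Submodule.starProjection_eq_self_iff.2
      (Submodule.starProjection_apply_mem _ _), WithLp.prod_inner_apply]
  simp only [WithLp.ofLp_fst, inner_zero_right, WithLp.ofLp_snd, zero_add]
  rfl

theorem norm_parallelKernel_apply_le (S : E →L[𝕜] G) (R : E →L[𝕜] F) (y : F) :
    ‖parallelKernel S R y‖ ≤ ‖y‖ :=
  (WithLp.norm_snd_le _ _).trans (norm_distanceVector_le S R y)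

theorem norm_sub_parallelKernel_le [CompleteSpace E] {S : E →L[𝕜] G} {R : E →L[𝕜] F} {v : F}
    {w : G} (h : ContinuousLinearMap.adjoint R v = ContinuousLinearMap.adjoint S w) :
    ‖v - parallelKernel S R v‖ ≤ ‖w‖ := by
  set P := (hilbertPair S R).rangeᗮ.starProjection
  have hmem : WithLp.toLp 2 (-w, v) ∈ (hilbertPair S R).rangeᗮ := by
    rw [Submodule.mem_orthogonal']
    rintro _ ⟨x, rfl⟩
    rw [WithLp.prod_inner_apply]
    change ⟪-w, S x⟫_𝕜 + ⟪v, R x⟫_𝕜 = 0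
    rw [inner_neg_left, ← ContinuousLinearMap.adjoint_inner_left S,
      ← ContinuousLinearMap.adjoint_inner_left R, h, neg_add_cancel]
  have hsplit : (WithLp.toLp 2 (0, v) : WithLp 2 (G × F)) =
      WithLp.toLp 2 (-w, v) + WithLp.toLp 2 (w, 0) := by
    rw [← WithLp.toLp_add, Prod.mk_add_mk, neg_add_cancel, add_zero]
  have hsub : (WithLp.toLp 2 (0, v) : WithLp 2 (G × F)) - distanceVector S R v =
      (hilbertPair S R).rangeᗮᗮ.starProjection (WithLp.toLp 2 (w, 0)) := by
    rw [distanceVector_apply, hsplit, Submodule.starProjection_orthogonal (hilbertPair S R).rangeᗮ,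
      map_add, Submodule.starProjection_eq_self_iff.2 hmem, add_sub_add_left_eq_sub]
    rfl
  calc ‖v - parallelKernel S R v‖
      = ‖((WithLp.toLp 2 (0, v) : WithLp 2 (G × F)) - distanceVector S R v).snd‖ := rfl
    _ ≤ ‖(WithLp.toLp 2 (w, 0) : WithLp 2 (G × F))‖ := by
      rw [hsub]
      exact (WithLp.norm_snd_le _ _).trans (Submodule.norm_starProjection_apply_le _ _)
    _ = ‖w‖ := WithLp.norm_toLp_fst 2 G F w

end ParallelKernel

section ParallelSum

variable {𝕜 E F G : Type*} [RCLike 𝕜] [NormedAddCommGroup E] [InnerProductSpace 𝕜 E]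
  [CompleteSpace E] [NormedAddCommGroup F] [InnerProductSpace 𝕜 F] [CompleteSpace F]
  [NormedAddCommGroup G] [InnerProductSpace 𝕜 G] [CompleteSpace G]

open ContinuousLinearMap in
theorem norm_sub_parallelKernel_smul_le {S : E →L[𝕜] G} {R : E →L[𝕜] F} {v : F} {w : G}
    (h : adjoint R v = adjoint S w) {n : ℕ} (hn : n ≠ 0) :
    ‖v - parallelKernel ((n : 𝕜) • S) R v‖ ≤ ‖w‖ / n := by
  have hn' : (n : 𝕜) ≠ 0 := Nat.cast_ne_zero.2 hn
  refine (norm_sub_parallelKernel_le (w := (n : 𝕜)⁻¹ • w) ?_).trans_eq ?_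
  · rw [h, map_smul, map_smulₛₗ, smul_apply, map_natCast, inv_smul_smul₀ hn']
  · rw [norm_smul, norm_inv, RCLike.norm_natCast, inv_mul_eq_div]

theorem tendsto_parallelKernel {S : E →L[𝕜] G} {R : E →L[𝕜] F}
    (h : Dense (ContinuousLinearMap.adjoint R ⁻¹' (ContinuousLinearMap.adjoint S).range)) (v : F) :
    Tendsto (fun n : ℕ => parallelKernel ((n : 𝕜) • S) R v) atTop (𝓝 v) := by
  have hclosed : IsClosed {v | Tendsto (fun n : ℕ => parallelKernel ((n : 𝕜) • S) R v) atTop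
      (𝓝 v)} := by
    refine Equicontinuous.isClosed_setOfPred_tendsto ?_ continuous_id
    refine (LipschitzWith.uniformEquicontinuous _ 1 fun n => ?_).equicontinuous
    exact (parallelKernel ((n : 𝕜) • S) R).lipschitzWith_of_opNorm_le <|
      ContinuousLinearMap.opNorm_le_bound _ zero_le_one fun y => by
        simpa using norm_parallelKernel_apply_le ((n : 𝕜) • S) R y
  refine closure_minimal ?_ hclosed (h v)
  rintro v ⟨w, hw⟩
  refine tendsto_iff_norm_sub_tendsto_zero.2 ?_
  refine squeeze_zero' (.of_forall fun n => norm_nonneg _) ?_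
    (tendsto_const_div_atTop_nhds_zero_nat ‖w‖)
  filter_upwards [eventually_ne_atTop 0] with n hn
  rw [norm_sub_rev]
  exact norm_sub_parallelKernel_smul_le hw.symm hn

end ParallelSum

section AbsCont

variable {H : Type*} [NormedAddCommGroup H] [InnerProductSpace ℂ H] [CompleteSpace H]

theorem tendsto_norm_opSqrt {C : ℕ → PosOp H} {A : PosOp H} {x : H}
    (h : Tendsto (fun n => (C n).1 x) atTop (𝓝 (A.1 x))) :
    Tendsto (fun n => ‖opSqrt (C n).1 x‖) atTop (𝓝 ‖opSqrt A.1 x‖) := by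
  have hform : Tendsto (fun n => √(⟪(C n).1 x, x⟫_ℂ).re) atTop (𝓝 √(⟪A.1 x, x⟫_ℂ).re) :=
    (Complex.continuous_re.tendsto _).comp (h.inner tendsto_const_nhds) |>.sqrt
  simpa only [← norm_opSqrt_sq (C _).2, ← norm_opSqrt_sq A.2, Real.sqrt_sq (norm_nonneg _)]
    using hform

theorem le_of_monotone_of_tendsto {C : ℕ → PosOp H} {A : PosOp H} (hC : Monotone C)
    (h : ∀ x, Tendsto (fun n => (C n).1 x) atTop (𝓝 (A.1 x))) (n : ℕ) : C n ≤ A :=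
  posOp_le_iff_norm_le.2 fun x =>
    Monotone.ge_of_tendsto (fun _ _ hij => posOp_le_iff_norm_le.1 (hC hij) x)
      (tendsto_norm_opSqrt (h x)) n

theorem norm_opSqrt_le_norm_sub {A B C : PosOp H} (hCA : C ≤ A) (hCB : Dominated C B) {v : H}
    (hv : v ∈ ((rootRange B).comap (opSqrt A.1).toLinearMap)ᗮ) (x : H) :
    ‖opSqrt C.1 x‖ ≤ ‖opSqrt A.1 x - v‖ := by
  obtain ⟨V, hVA, hV⟩ := exists_comp_eq_of_norm_le (R := opSqrt C.1) zero_le_one fun x =>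
    (posOp_le_iff_norm_le.1 hCA x).trans_eq (one_mul _).symm
  have hrange : ∀ y, opSqrt A.1 (ContinuousLinearMap.adjoint V y) = opSqrt C.1 y := fun y => by
    rw [← adjoint_opSqrt C.1, ← hVA, ContinuousLinearMap.adjoint_comp, adjoint_opSqrt]
    rfl
  have hVv : V v = 0 := ext_inner_right ℂ fun y => by
    rw [← ContinuousLinearMap.adjoint_inner_right, inner_zero_left]
    refine (Submodule.mem_orthogonal' _ _).1 hv _ (dominated_iff_rootRange_le.1 hCB ?_)
    exact ⟨y, (hrange y).symm⟩
  calc ‖opSqrt C.1 x‖ = ‖V (opSqrt A.1 x - v)‖ := by rw [map_sub, hVv, sub_zero, ← hVA]; rfl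
    _ ≤ ‖opSqrt A.1 x - v‖ := V.le_of_opNorm_le hV _ |>.trans_eq (one_mul _)

theorem AbsCont.dense_preimage_rootRange {A B : PosOp H} (h : AbsCont A B) :
    Dense (opSqrt A.1 ⁻¹' rootRange B) := by
  obtain ⟨C, hmono, hdom, hlim⟩ := h
  set M : Submodule ℂ H := (rootRange B).comap (opSqrt A.1).toLinearMap
  suffices hM : ∀ v ∈ Mᗮ, v = 0 from
    (Submodule.dense_iff_topologicalClosure_eq_top (s := M)).2
      (M.topologicalClosure_eq_top_iff.2 ((Submodule.eq_bot_iff _).2 hM))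
  intro v hv
  have hnorm : ∀ y ∈ closure ((opSqrt A.1).range : Set H), ‖y‖ ≤ ‖y - v‖ := by
    refine closure_minimal ?_
      (isClosed_le continuous_norm (continuous_id.sub continuous_const).norm)
    rintro _ ⟨x, rfl⟩
    exact le_of_tendsto' (tendsto_norm_opSqrt (hlim x)) fun n =>
      norm_opSqrt_le_norm_sub (le_of_monotone_of_tendsto hmono hlim n) (hdom n) hv x
  have hker : (opSqrt A.1).ker ≤ M := fun x (hx : opSqrt A.1 x = 0) => by
    change opSqrt A.1 x ∈ rootRange B
    rw [hx]
    exact zero_mem _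
  have hvA : v ∈ closure ((opSqrt A.1).range : Set H) := by
    have := Submodule.orthogonal_le hker hv
    rw [ContinuousLinearMap.orthogonal_ker, adjoint_opSqrt] at this
    exact this
  simpa using hnorm v hvA

/-- The parallel sum of `R* R` and `S* S`. -/
def parallelSum {F G : Type*} [NormedAddCommGroup F] [InnerProductSpace ℂ F] [CompleteSpace F]
    [NormedAddCommGroup G] [InnerProductSpace ℂ G] [CompleteSpace G] (S : H →L[ℂ] G)
    (R : H →L[ℂ] F) : PosOp H :=
  ⟨ContinuousLinearMap.adjoint R ∘L parallelKernel S R ∘L R, by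
    refine .adjoint_conj (ContinuousLinearMap.isPositive_iff_complex _ |>.2 fun y => ?_) R
    rw [inner_parallelKernel, inner_self_eq_norm_sq_to_K]
    norm_cast
    exact ⟨rfl, by positivity⟩⟩

theorem norm_opSqrt_parallelSum {F G : Type*} [NormedAddCommGroup F] [InnerProductSpace ℂ F]
    [CompleteSpace F] [NormedAddCommGroup G] [InnerProductSpace ℂ G] [CompleteSpace G]
    (S : H →L[ℂ] G) (R : H →L[ℂ] F) (x : H) :
    ‖opSqrt (parallelSum S R).1 x‖ = ‖distanceVector S R (R x)‖ := by
  refine (norm_opSqrt_eq_iff (parallelSum S R).2 (norm_nonneg _)).2 ?_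
  change (⟪ContinuousLinearMap.adjoint R (parallelKernel S R (R x)), x⟫_ℂ).re = _
  rw [ContinuousLinearMap.adjoint_inner_left, inner_parallelKernel, inner_self_eq_norm_sq_to_K]
  norm_cast

theorem absCont_of_dense_preimage {A B : PosOp H} (h : Dense (opSqrt A.1 ⁻¹' rootRange B)) :
    AbsCont A B := by
  refine ⟨fun n => parallelSum ((n : ℂ) • opSqrt B.1) (opSqrt A.1), fun n m hnm => ?_,
    fun n => dominated_iff_norm_le.2 ⟨n, n.cast_nonneg, fun x => ?_⟩, fun x => ?_⟩
  · refine posOp_le_iff_norm_le.2 fun x => ?_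
    rw [norm_opSqrt_parallelSum, norm_opSqrt_parallelSum]
    refine norm_distanceVector_mono (fun y => ?_) _ _
    rw [smul_apply, smul_apply, norm_smul, norm_smul, Complex.norm_natCast, Complex.norm_natCast]
    gcongr
  · rw [norm_opSqrt_parallelSum]
    refine (norm_distanceVector_apply_le _ _ x).trans_eq ?_
    rw [smul_apply, norm_smul, Complex.norm_natCast]
  · have hlim := tendsto_parallelKernel (S := opSqrt B.1) (R := opSqrt A.1)
      (by rwa [adjoint_opSqrt, adjoint_opSqrt]) (opSqrt A.1 x)
    have := ((opSqrt A.1).continuous.tendsto _).comp hlim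
    rw [opSqrt_opSqrt A.2] at this
    refine this.congr fun n => ?_
    change _ = ContinuousLinearMap.adjoint (opSqrt A.1) _
    rw [adjoint_opSqrt]
    rfl

theorem absCont_iff_dense_preimage {A B : PosOp H} :
    AbsCont A B ↔ Dense (opSqrt A.1 ⁻¹' rootRange B) :=
  ⟨AbsCont.dense_preimage_rootRange, absCont_of_dense_preimage⟩

end AbsCont

theorem finiteDimensional_of_isAtom {k V : Type*} [DivisionRing k] [AddCommGroup V] [Module k V]
    {L : Submodule k V} (hL : IsAtom L) : FiniteDimensional k L := by
  obtain ⟨v, -, rfl⟩ := (atom_iff_nonzero_span L).1 hL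
  infer_instance

section RangeOrder

variable {H K : Type*} [NormedAddCommGroup H] [InnerProductSpace ℂ H] [CompleteSpace H]
  [NormedAddCommGroup K] [InnerProductSpace ℂ K] [CompleteSpace K]

theorem absCont_of_rootRange_le {A B : PosOp H} (h : rootRange A ≤ rootRange B) : AbsCont A B :=
  ⟨fun _ => A, monotone_const, fun _ => dominated_iff_rootRange_le.2 h,
    fun _ => tendsto_const_nhds⟩

theorem absCont_iff_rootRange_le {A B : PosOp H}
    [FiniteDimensional ℂ ↥(rootRange A ⊓ rootRange B)] :
    AbsCont A B ↔ rootRange A ≤ rootRange B := by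
  refine ⟨fun h => ?_, absCont_of_rootRange_le⟩
  have hpre : opSqrt A.1 ⁻¹' rootRange B = opSqrt A.1 ⁻¹' ↑(rootRange A ⊓ rootRange B) :=
    Set.ext fun x => (and_iff_right ⟨x, rfl⟩).symm
  have hdense := h.dense_preimage_rootRange
  rw [hpre] at hdense
  have huniv := ((rootRange A ⊓ rootRange B).closed_of_finiteDimensional.preimage
    (opSqrt A.1).continuous).closure_eq.symm.trans hdense.closure_eq
  rintro _ ⟨x, rfl⟩
  exact (huniv.ge (Set.mem_univ x)).2

/-- A relation between positive operators that amounts to inclusion of root ranges as soon as the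
root ranges have a finite-dimensional intersection. Inclusion itself and absolute continuity are
such relations. -/
def IsWeakInclusion (r : PosOp H → PosOp H → Prop) : Prop :=
  ∀ A B, FiniteDimensional ℂ ↥(rootRange A ⊓ rootRange B) → (r A B ↔ rootRange A ≤ rootRange B)

theorem isWeakInclusion_absCont : IsWeakInclusion (AbsCont (H := H)) :=
  fun _ _ _ => absCont_iff_rootRange_le

theorem isWeakInclusion_rootRange_le :
    IsWeakInclusion fun A B : PosOp H => rootRange A ≤ rootRange B :=
  fun _ _ _ => Iff.rfl

namespace IsWeakInclusion

variable {r : PosOp H → PosOp H → Prop} (hr : IsWeakInclusion r)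
include hr

theorem iff_of_left {A : PosOp H} [FiniteDimensional ℂ (rootRange A)] (B : PosOp H) :
    r A B ↔ rootRange A ≤ rootRange B :=
  hr A B inferInstance

theorem iff_of_right (A : PosOp H) {B : PosOp H} [FiniteDimensional ℂ (rootRange B)] :
    r A B ↔ rootRange A ≤ rootRange B :=
  hr A B inferInstance

theorem rootRange_eq_bot_iff_forall {A : PosOp H} : rootRange A = ⊥ ↔ ∀ B, r A B := by
  constructor
  · intro hA B
    have : FiniteDimensional ℂ (rootRange A) := by
      rw [hA]
      infer_instance
    exact (hr.iff_of_left B).2 (hA.trans_le bot_le)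
  · intro hA
    have : FiniteDimensional ℂ (rootRange (projOp (⊥ : Submodule ℂ H))) := by
      rw [rootRange_projOp]
      infer_instance
    have hle := (hr.iff_of_right A).1 (hA (projOp ⊥))
    rwa [rootRange_projOp, le_bot_iff] at hle

theorem isAtom_rootRange_iff_forall {A : PosOp H} :
    IsAtom (rootRange A) ↔
      rootRange A ≠ ⊥ ∧ ∀ B, rootRange B ≠ ⊥ → r B A → r A B := by
  constructor
  · intro hA
    have := finiteDimensional_of_isAtom hA
    refine ⟨hA.1, fun B hB hBA => (hr.iff_of_left B).2 ?_⟩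
    exact ((hA.le_iff.1 ((hr.iff_of_right B).1 hBA)).resolve_left hB).ge
  · rintro ⟨hA, h⟩
    obtain ⟨x, hxA, hx⟩ := Submodule.exists_mem_ne_zero_of_ne_bot hA
    have hspan : rootRange (projOp (ℂ ∙ x)) = ℂ ∙ x := rootRange_projOp _
    have hatom : IsAtom (rootRange (projOp (ℂ ∙ x))) := by
      rw [hspan]
      exact nonzero_span_atom x hx
    have := finiteDimensional_of_isAtom hatom
    have hle : rootRange (projOp (ℂ ∙ x)) ≤ rootRange A := by
      rwa [hspan, Submodule.span_singleton_le_iff_mem]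
    have hge := (hr.iff_of_right A).1 (h _ hatom.1 ((hr.iff_of_left A).2 hle))
    exact hge.antisymm hle ▸ hatom

theorem rootRange_le_iff_forall {A B : PosOp H} :
    rootRange A ≤ rootRange B ↔ ∀ C, IsAtom (rootRange C) → r C A → r C B := by
  have hr_atom : ∀ C D, IsAtom (rootRange C) → (r C D ↔ rootRange C ≤ rootRange D) :=
    fun C D hC => have := finiteDimensional_of_isAtom hC; hr.iff_of_left D
  constructor
  · intro h C hC hCA
    rw [hr_atom C _ hC] at hCA ⊢
    exact hCA.trans h
  · refine fun h => le_iff_atom_le_imp.2 fun L hL hLA => ?_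
    have := finiteDimensional_of_isAtom hL
    have hC := rootRange_projOp L
    have hLB := h (projOp L) (hC.symm ▸ hL) ((hr_atom _ _ (hC.symm ▸ hL)).2 (hC.trans_le hLA))
    exact hC.ge.trans ((hr_atom _ _ (hC.symm ▸ hL)).1 hLB)

variable {s : PosOp K → PosOp K → Prop} (hs : IsWeakInclusion s) {φ : PosOp H → PosOp K}
  (hφ : Function.Surjective φ) (h : ∀ A B, r A B ↔ s (φ A) (φ B))
include hs hφ h

theorem rootRange_eq_bot_iff_map (A : PosOp H) : rootRange A = ⊥ ↔ rootRange (φ A) = ⊥ := by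
  rw [hr.rootRange_eq_bot_iff_forall, hs.rootRange_eq_bot_iff_forall, hφ.forall]
  exact forall_congr' fun B => h A B

theorem isAtom_rootRange_iff_map (A : PosOp H) :
    IsAtom (rootRange A) ↔ IsAtom (rootRange (φ A)) := by
  rw [hr.isAtom_rootRange_iff_forall, hs.isAtom_rootRange_iff_forall, hφ.forall]
  simp only [ne_eq, hr.rootRange_eq_bot_iff_map hs hφ h, h]

theorem rootRange_le_iff_map (A B : PosOp H) :
    rootRange A ≤ rootRange B ↔ rootRange (φ A) ≤ rootRange (φ B) := by
  rw [hr.rootRange_le_iff_forall, hs.rootRange_le_iff_forall, hφ.forall]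
  simp only [hr.isAtom_rootRange_iff_map hs hφ h, h]

end IsWeakInclusion

theorem rootRange_le_iff_forall_singular {A B : PosOp H} :
    rootRange A ≤ rootRange B ↔ ∀ C : PosOp H, Singular C B → Singular C A := by
  simp only [singular_iff_disjoint]
  refine ⟨fun h C hC => hC.mono_right h, fun h => le_iff_atom_le_imp.2 fun L hL hLA => ?_⟩
  have := finiteDimensional_of_isAtom hL
  have hLAB := h (projOp L)
  rw [rootRange_projOp] at hLAB
  by_contra hLB
  exact hL.1 ((hLAB (hL.not_le_iff_disjoint.1 hLB)).eq_bot_of_le hLA)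

theorem rootRange_le_iff_map_of_singular {φ : PosOp H → PosOp K} (hφ : Function.Surjective φ)
    (h : ∀ A B, Singular A B ↔ Singular (φ A) (φ B)) (A B : PosOp H) :
    rootRange A ≤ rootRange B ↔ rootRange (φ A) ≤ rootRange (φ B) := by
  rw [rootRange_le_iff_forall_singular, rootRange_le_iff_forall_singular, hφ.forall]
  simp only [h]

end RangeOrder

section Semilinear

open Submodule

variable {K L V W : Type*} [DivisionRing K] [DivisionRing L] [AddCommGroup V] [Module K V]
  [AddCommGroup W] [Module L W]

theorem eq_and_eq_of_smul_add_eq {w : W} {S : Submodule L W} (hw : w ∉ S) {a b : L} {s t : W}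
    (hs : s ∈ S) (ht : t ∈ S) (h : a • w + s = b • w + t) : a = b ∧ s = t := by
  have hab : a = b := by
    by_contra hab
    have hsub : (a - b) • w = t - s := by
      rw [sub_smul, sub_eq_sub_iff_add_eq_add, h, add_comm]
    exact hw ((S.smul_mem_iff (sub_ne_zero.2 hab)).1 (hsub ▸ S.sub_mem ht hs))
  subst hab
  exact ⟨rfl, add_left_cancel h⟩

theorem map_add_of_map_add_of_notMem_span {t : V → W} (hV : ∀ x : V, ∃ z, z ∉ span K {x})
    (h : ∀ x y, y ∉ span K {x} → t (x + y) = t x + t y) (x y : V) : t (x + y) = t x + t y := by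
  by_cases hy : y ∈ span K {x}
  swap
  · exact h x y hy
  obtain ⟨z, hz⟩ := hV x
  have hadd : ∀ w ∈ span K {x}, t (w + z) = t w + t z := fun w hw =>
    h w z fun hzw => hz ((span_singleton_le_iff_mem _ _).2 hw hzw)
  have hx := mem_span_singleton_self (R := K) x
  refine add_right_cancel (b := t z) ?_
  calc t (x + y) + t z = t (x + (y + z)) := by rw [← hadd _ (add_mem hx hy), add_assoc]
    _ = t x + (t y + t z) := by rw [h _ _ (mt (Submodule.add_mem_iff_right _ hy).1 hz), hadd y hy]
    _ = t x + t y + t z := (add_assoc _ _ _).symm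

variable (t : V →+ W) (hline : ∀ (c : K) x, t (c • x) ∈ span L {t x})
  {x₀ y₀ : V} (hx₀ : t x₀ ≠ 0) (hy₀ : t y₀ ∉ span L {t x₀})
include hline hx₀ hy₀

theorem exists_map_smul_eq : ∃ s : K → L, ∀ c x, t (c • x) = s c • t x := by
  choose s hs using fun c x => mem_span_singleton.1 (hline c x)
  have hindep : ∀ {x y}, t x ≠ 0 → t y ∉ span L {t x} → ∀ c, s c x = s c y := by
    intro x y hx hy c
    have hsum : s c (x + y) • t y + s c (x + y) • t x = s c y • t y + s c x • t x := by
      rw [hs, hs, ← smul_add, ← map_add, ← map_add, ← smul_add, add_comm y x, hs]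
    obtain ⟨hsy, hsx⟩ := eq_and_eq_of_smul_add_eq hy (smul_mem _ _ (mem_span_singleton_self _))
      (smul_mem _ _ (mem_span_singleton_self _)) hsum
    exact (smul_left_injective L hx hsx).symm.trans hsy
  refine ⟨fun c => s c x₀, fun c x => ?_⟩
  by_cases hx : t x = 0
  · rw [← hs, hx, smul_zero, smul_zero]
  rw [← hs]
  congr 1
  by_cases hxx₀ : t x ∈ span L {t x₀}
  · have hy₀x : t y₀ ∉ span L {t x} := fun h => hy₀ ((span_singleton_le_iff_mem _ _).2 hxx₀ h)
    exact (hindep hx hy₀x c).trans (hindep hx₀ hy₀ c).symm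
  · exact (hindep hx₀ hxx₀ c).symm

theorem exists_ringHom_map_smul_eq : ∃ σ : K →+* L, ∀ c x, t (c • x) = σ c • t x := by
  obtain ⟨s, hs⟩ := exists_map_smul_eq t hline hx₀ hy₀
  have hinj : ∀ a b : L, a • t x₀ = b • t x₀ → a = b := fun _ _ h => smul_left_injective L hx₀ h
  refine ⟨⟨⟨⟨s, hinj _ _ ?_⟩, fun a b => hinj _ _ ?_⟩, hinj _ _ ?_, fun a b => hinj _ _ ?_⟩, hs⟩
  · rw [← hs, one_smul, one_smul]
  · simp only [mul_smul, ← hs]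
  · simp only [← hs, zero_smul, map_zero]
  · simp only [add_smul, ← hs, map_add]

end Semilinear

section Collineation

open Submodule

variable {K L V W : Type*} [DivisionRing K] [DivisionRing L] [AddCommGroup V] [Module K V]
  [AddCommGroup W] [Module L W]

/-- A collineation of projective spaces, given by a map `u` on representatives of points: it
preserves and reflects collinearity and reaches every point. The zero vector is allowed as a
representative, so that coinciding points need no separate clause. -/
structure IsCollineation (K L : Type*) {V W : Type*} [DivisionRing K] [DivisionRing L]
    [AddCommGroup V] [Module K V] [AddCommGroup W] [Module L W] (u : V → W) : Prop where
  mem_span_pair_iff : ∀ x y z, u z ∈ span L {u x, u y} ↔ z ∈ span K {x, y}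
  exists_span_eq : ∀ w, ∃ x, span L {u x} = span L {w}

/-- Representatives `t` of the points of a hyperplane `N`, scaled so that `u e + t w` represents the
point of `e + w`. -/
structure IsNormalizedOn {K : Type*} (L : Type*) {V W : Type*} [DivisionRing K] [DivisionRing L]
    [AddCommGroup V] [Module K V] [AddCommGroup W] [Module L W] (u : V → W) (e : V)
    (N : Submodule K V) (t : N → W) : Prop where
  span_eq : ∀ w, span L {t w} = span L {u w}
  span_add_eq : ∀ w : N, span L {u e + t w} = span L {u (e + w)}

namespace IsCollineation

variable {u : V → W} (hu : IsCollineation K L u)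
include hu

theorem mem_span_singleton_iff {x z : V} : u z ∈ span L {u x} ↔ z ∈ span K {x} := by
  simpa using hu.mem_span_pair_iff x x z

theorem eq_zero_iff {x : V} : u x = 0 ↔ x = 0 := by
  obtain ⟨y, hy⟩ := hu.exists_span_eq 0
  rw [span_zero_singleton, span_singleton_eq_bot] at hy
  have hiff : ∀ z, u z = 0 ↔ z ∈ span K {y} := fun z => by
    rw [← hu.mem_span_singleton_iff, hy, span_zero_singleton, Submodule.mem_bot]
  have hzero : u 0 = 0 := (hiff 0).2 (zero_mem _)
  simpa [hzero] using hu.mem_span_singleton_iff (x := 0) (z := x)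

theorem span_eq_span_iff {x y : V} : span L {u x} = span L {u y} ↔ span K {x} = span K {y} := by
  simp only [le_antisymm_iff, span_singleton_le_iff_mem, hu.mem_span_singleton_iff]

theorem exists_isNormalizedOn {e : V} {N : Submodule K V} (he : e ∉ N) :
    ∃ t : N → W, IsNormalizedOn L u e N t := by
  have h : ∀ w : N, ∃ s : W, span L {s} = span L {u w} ∧
      span L {u e + s} = span L {u (e + w)} := by
    intro w
    have hu0 : u 0 = 0 := hu.eq_zero_iff.2 rfl
    by_cases hw0 : (w : V) = 0
    · exact ⟨0, by simp [hw0, hu0]⟩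
    obtain ⟨a, b, hab⟩ := mem_span_pair.1 <| (hu.mem_span_pair_iff e w (e + w)).2 <|
      mem_span_pair.2 ⟨1, 1, by rw [one_smul, one_smul]⟩
    have ha : a ≠ 0 := by
      rintro rfl
      rw [zero_smul, zero_add] at hab
      have := hu.mem_span_singleton_iff.1 (hab ▸ smul_mem _ b (mem_span_singleton_self _))
      exact he ((Submodule.add_mem_iff_left _ w.2).1 ((span_singleton_le_iff_mem _ _).2 w.2 this))
    have hb : b ≠ 0 := by
      rintro rfl
      rw [zero_smul, add_zero] at hab
      have := hu.mem_span_singleton_iff.1 (hab ▸ smul_mem _ a (mem_span_singleton_self _))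
      obtain ⟨c, hc⟩ := mem_span_singleton.1 <|
        (Submodule.add_mem_iff_right _ (mem_span_singleton_self e)).1 this
      have hc0 : c ≠ 0 := by
        rintro rfl
        exact hw0 (by rw [← hc, zero_smul])
      exact he ((N.smul_mem_iff hc0).1 (hc ▸ w.2))
    refine ⟨(a⁻¹ * b) • u w, ?_, ?_⟩
    · exact span_singleton_smul_eq (IsUnit.mk0 _ (mul_ne_zero (inv_ne_zero ha) hb)) _
    · rw [← span_singleton_smul_eq (IsUnit.mk0 _ ha) (u e + _), smul_add, smul_smul,
        mul_inv_cancel_left₀ ha, hab]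
  choose t ht using h
  exact ⟨t, fun w => (ht w).1, fun w => (ht w).2⟩

variable {e : V} {N : Submodule K V} {t : N → W} (ht : IsNormalizedOn L u e N t)
include ht

theorem normalized_eq_zero_iff {w : N} : t w = 0 ↔ w = 0 := by
  rw [← span_singleton_eq_bot (R := L), ht.span_eq, span_singleton_eq_bot, hu.eq_zero_iff,
    ZeroMemClass.coe_eq_zero]

theorem normalized_mem_span_singleton_iff {x y : N} : t y ∈ span L {t x} ↔ y ∈ span K {x} := by
  rw [← span_singleton_le_iff_mem, ht.span_eq, ht.span_eq, span_singleton_le_iff_mem,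
    hu.mem_span_singleton_iff, mem_span_singleton, mem_span_singleton]
  simp only [← N.coe_smul, Subtype.coe_inj]

theorem notMem_span_normalized_pair (he : e ∉ N) (x y : N) : u e ∉ span L {t x, t y} := by
  rw [span_insert, ht.span_eq, ht.span_eq, ← span_insert, hu.mem_span_pair_iff]
  exact fun h => he (span_le.2 (Set.pair_subset x.2 y.2) h)

theorem normalized_add_mem_span_pair (x y : N) : t (x + y) ∈ span L {t x, t y} := by
  rw [← span_singleton_le_iff_mem, ht.span_eq, span_singleton_le_iff_mem, span_insert, ht.span_eq,
    ht.span_eq, ← span_insert, hu.mem_span_pair_iff]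
  exact mem_span_pair.2 ⟨1, 1, by rw [one_smul, one_smul, N.coe_add]⟩

theorem map_add_mem_span_pair (x y : N) : u (e + (x + y : N)) ∈ span L {u e + t x, t y} := by
  rw [span_insert, ht.span_add_eq, ht.span_eq, ← span_insert, hu.mem_span_pair_iff]
  exact mem_span_pair.2 ⟨1, 1, by rw [one_smul, one_smul, N.coe_add, add_assoc]⟩

/-- The point of `e + (x + y)` lies on the line through `e + x` and `y` and on the line through
`e + y` and `x`. -/
theorem exists_map_add_eq_smul (he : e ∉ N) {x y : N} (hxy : y ∉ span K {x}) :
    ∃ a : L, u (e + (x + y : N)) = a • u e + a • (t x + t y) := by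
  have hx : t x ∈ span L {t x, t y} := subset_span (.inl rfl)
  have hy : t y ∈ span L {t x, t y} := subset_span (.inr rfl)
  obtain ⟨a, b, hab⟩ := mem_span_pair.1 (hu.map_add_mem_span_pair ht x y)
  obtain ⟨a', b', hab'⟩ := mem_span_pair.1 (add_comm y x ▸ hu.map_add_mem_span_pair ht y x)
  rw [smul_add, add_assoc] at hab hab'
  obtain ⟨rfl, hplane⟩ := eq_and_eq_of_smul_add_eq (hu.notMem_span_normalized_pair ht he x y)
    (add_mem (smul_mem _ a hx) (smul_mem _ b hy))
    (add_mem (smul_mem _ a' hy) (smul_mem _ b' hx)) (hab.trans hab'.symm)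
  obtain ⟨rfl, -⟩ := eq_and_eq_of_smul_add_eq
    (mt (hu.normalized_mem_span_singleton_iff ht).1 hxy)
    (smul_mem _ a (mem_span_singleton_self _)) (smul_mem _ b' (mem_span_singleton_self _))
    ((add_comm _ _).trans hplane)
  exact ⟨b, by rw [← hab, smul_add]⟩

theorem normalized_add (he : e ∉ N) (hN : ∀ x : N, ∃ z, z ∉ span K {x}) (x y : N) :
    t (x + y) = t x + t y := by
  refine map_add_of_map_add_of_notMem_span hN (fun x y hxy => ?_) x y
  obtain ⟨a, ha⟩ := hu.exists_map_add_eq_smul ht he hxy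
  have hmem : u e + t (x + y) ∈ span L {u (e + (x + y : N))} :=
    ht.span_add_eq (x + y) ▸ mem_span_singleton_self _
  obtain ⟨k, hk⟩ := mem_span_singleton.1 hmem
  have hxy_mem : t x + t y ∈ span L {t x, t y} :=
    add_mem (subset_span (.inl rfl)) (subset_span (.inr rfl))
  rw [ha, smul_add, smul_smul, smul_smul, ← one_smul L (u e), smul_smul, mul_one] at hk
  obtain ⟨hka, hadd⟩ := eq_and_eq_of_smul_add_eq (hu.notMem_span_normalized_pair ht he x y)
    (smul_mem _ _ hxy_mem) (hu.normalized_add_mem_span_pair ht x y) hk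
  rw [← hadd, hka, one_smul]

theorem exists_semilinear_normalized (he : e ∉ N) (hN : ∀ x : N, ∃ z, z ∉ span K {x}) :
    ∃ (σ : K →+* L) (t' : N →ₛₗ[σ] W), ∀ w, t' w = t w := by
  let tAdd : N →+ W := .mk' t (hu.normalized_add ht he hN)
  have hline : ∀ (c : K) x, tAdd (c • x) ∈ span L {tAdd x} := fun c x =>
    (hu.normalized_mem_span_singleton_iff ht).2 (smul_mem _ c (mem_span_singleton_self x))
  obtain ⟨x, hx⟩ := hN 0
  obtain ⟨y, hy⟩ := hN x
  rw [span_zero_singleton, Submodule.mem_bot] at hx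
  obtain ⟨σ, hσ⟩ := exists_ringHom_map_smul_eq tAdd hline (mt (hu.normalized_eq_zero_iff ht).1 hx)
    (mt (hu.normalized_mem_span_singleton_iff ht).1 hy)
  exact ⟨σ, { tAdd with map_smul' := hσ }, fun _ => rfl⟩

theorem span_map_smul_add_eq {σ : K →+* L} {T : V →ₛₗ[σ] W} (hTe : T e = u e)
    (hTN : ∀ w : N, T w = t w) (a : K) (w : N) :
    span L {T (a • e + w)} = span L {u (a • e + w)} := by
  obtain rfl | ha := eq_or_ne a 0
  · simp only [zero_smul, zero_add, hTN, ht.span_eq]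
  have hunit : IsUnit a := IsUnit.mk0 a ha
  have hfactor : a • e + (w : V) = a • (e + (a⁻¹ • w : N)) := by
    rw [smul_add, N.coe_smul, smul_inv_smul₀ ha]
  rw [hfactor, map_smulₛₗ, span_singleton_smul_eq (hunit.map σ), map_add, hTe, hTN, ht.span_add_eq,
    hu.span_eq_span_iff, span_singleton_smul_eq hunit]

omit ht

theorem exists_semilinear (hV : ∀ x y : V, ∃ z, z ∉ span K {x, y}) :
    ∃ (σ : K →+* L) (T : V →ₛₗ[σ] W), ∀ x, span L {T x} = span L {u x} := by
  obtain ⟨e, he⟩ := hV 0 0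
  have he0 : e ≠ 0 := by simpa using he
  obtain ⟨f, hf⟩ := (LinearMap.toSpanSingleton K V e).exists_leftInverse_of_injective
    (LinearMap.ker_toSpanSingleton K he0)
  have hfe : f e = 1 := by simpa using LinearMap.congr_fun hf 1
  let q : V →ₗ[K] f.ker := (LinearMap.id - f.smulRight e).codRestrict f.ker fun x => by simp [hfe]
  have hdecomp : ∀ x, f x • e + (q x : V) = x := fun x => add_sub_cancel _ _
  have hN : ∀ x : f.ker, ∃ z, z ∉ span K {x} := fun x => by
    obtain ⟨z, hz⟩ := hV e x
    refine ⟨q z, fun hqz => hz ?_⟩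
    obtain ⟨c, hc⟩ := mem_span_singleton.1 hqz
    exact mem_span_pair.2 ⟨f z, c, by rw [← f.ker.coe_smul, hc, hdecomp]⟩
  have heN : e ∉ f.ker := by simp [hfe]
  obtain ⟨t₀, ht₀⟩ := hu.exists_isNormalizedOn heN
  obtain ⟨σ, t, ht⟩ := hu.exists_semilinear_normalized ht₀ heN hN
  let T : V →ₛₗ[σ] W :=
    (LinearMap.toSpanSingleton L W (u e)).comp (σ.toSemilinearMap.comp f) + t.comp q
  have hT : ∀ x, T x = σ (f x) • u e + t (q x) := fun _ => rfl
  have hqe : q e = 0 := Subtype.ext (by simpa [hfe] using hdecomp e)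
  have hqN : ∀ w : f.ker, q w = w := fun w => Subtype.ext (by simpa using hdecomp w)
  refine ⟨σ, T, fun x => ?_⟩
  rw [← hdecomp x]
  exact hu.span_map_smul_add_eq ht₀ (by simp [hT, hfe, hqe]) (fun w => by simp [hT, hqN, ht]) _ _

theorem of_span_eq {t : V → W} (h : ∀ x, span L {t x} = span L {u x}) : IsCollineation K L t where
  mem_span_pair_iff x y z := by
    rw [← span_singleton_le_iff_mem, span_insert, h, h, h, ← span_insert, span_singleton_le_iff_mem,
      hu.mem_span_pair_iff]
  exists_span_eq w := by simpa only [h] using hu.exists_span_eq w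

omit hu

variable {σ : K →+* L} {T : V →ₛₗ[σ] W} (hT : IsCollineation K L T)
include hT

theorem injective : Function.Injective T :=
  (injective_iff_map_eq_zero T).2 fun _ => hT.eq_zero_iff.1

/-- The point of `T e + d • T x` is the image of that of some `a • e + b • x`, whence
`d = σ (a⁻¹ * b)`. -/
theorem surjective_ringHom {e x : V} (he : e ≠ 0) (hx : x ∉ span K {e}) :
    Function.Surjective σ := by
  intro d
  obtain ⟨v, hv⟩ := hT.exists_span_eq (T e + d • T x)
  have hv_line : v ∈ span K {e, x} := by
    rw [← hT.mem_span_pair_iff, ← span_singleton_le_iff_mem, hv, span_singleton_le_iff_mem]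
    exact mem_span_pair.2 ⟨1, d, by rw [one_smul]⟩
  obtain ⟨a, b, rfl⟩ := mem_span_pair.1 hv_line
  obtain ⟨k, hk⟩ := mem_span_singleton.1 (hv ▸ mem_span_singleton_self (T e + d • T x))
  have hcomb : (k * σ b) • T x + (k * σ a) • T e = d • T x + (1 : L) • T e := by
    rw [add_comm, one_smul, add_comm _ (T e), ← hk, map_add, map_smulₛₗ, map_smulₛₗ, smul_add,
      smul_smul, smul_smul]
  obtain ⟨hb, ha⟩ := eq_and_eq_of_smul_add_eq (mt hT.mem_span_singleton_iff.1 hx)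
    (smul_mem _ _ (mem_span_singleton_self _)) (smul_mem _ _ (mem_span_singleton_self _)) hcomb
  have hka : k * σ a = 1 := smul_left_injective L (mt hT.eq_zero_iff.1 he) ha
  exact ⟨a⁻¹ * b, by rw [map_mul, map_inv₀, ← hb, eq_inv_of_mul_eq_one_left hka]⟩

theorem surjective (hσ : Function.Surjective σ) : Function.Surjective T := by
  intro w
  obtain ⟨x, hx⟩ := hT.exists_span_eq w
  obtain ⟨d, hd⟩ := mem_span_singleton.1 (hx ▸ mem_span_singleton_self w)
  obtain ⟨c, rfl⟩ := hσ d
  exact ⟨c • x, by rw [map_smulₛₗ, hd]⟩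

end IsCollineation
end Collineation

section PointMap

open Submodule

theorem exists_eq_span_singleton_iff {k V : Type*} [DivisionRing k] [AddCommGroup V] [Module k V]
    {S : Submodule k V} : (∃ x, S = span k {x}) ↔ S = ⊥ ∨ IsAtom S := by
  constructor
  · rintro ⟨x, rfl⟩
    exact (eq_or_ne x 0).imp (span_singleton_eq_bot.2 ·) (nonzero_span_atom x ·)
  · rintro (rfl | hS)
    · exact ⟨0, span_zero_singleton k |>.symm⟩
    · obtain ⟨x, -, hx⟩ := (atom_iff_nonzero_span S).1 hS
      exact ⟨x, hx⟩

theorem exists_notMem_span_pair {k V : Type*} [DivisionRing k] [AddCommGroup V] [Module k V]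
    (hV : ¬ FiniteDimensional k V) (x y : V) : ∃ z, z ∉ span k {x, y} := by
  by_contra! hxy
  exact hV ⟨(eq_top_iff'.2 hxy : span k {x, y} = ⊤) ▸ fg_span (Set.toFinite _)⟩

variable {H K : Type*} [NormedAddCommGroup H] [InnerProductSpace ℂ H] [CompleteSpace H]
  [NormedAddCommGroup K] [InnerProductSpace ℂ K] [CompleteSpace K]
  {φ : PosOp H → PosOp K} (hφ : Function.Surjective φ)
  (h : ∀ A B, rootRange A ≤ rootRange B ↔ rootRange (φ A) ≤ rootRange (φ B))
include hφ h

theorem exists_rootRange_eq_span_singleton_iff_map (A : PosOp H) :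
    (∃ x, rootRange A = ℂ ∙ x) ↔ ∃ y, rootRange (φ A) = ℂ ∙ y := by
  have hr := isWeakInclusion_rootRange_le (H := H)
  have hs := isWeakInclusion_rootRange_le (H := K)
  rw [exists_eq_span_singleton_iff, exists_eq_span_singleton_iff,
    hr.rootRange_eq_bot_iff_map hs hφ h, hr.isAtom_rootRange_iff_map hs hφ h]

theorem isCollineation_of_mem_rootRange_iff {u : H → K}
    (hu : ∀ A x, u x ∈ rootRange (φ A) ↔ x ∈ rootRange A) : IsCollineation ℂ ℂ u where
  mem_span_pair_iff x y z := by
    constructor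
    · intro hz
      have := FiniteDimensional.span_of_finite ℂ (Set.toFinite {x, y})
      have hA := rootRange_projOp (span ℂ {x, y})
      rw [← hA, ← hu]
      refine span_le.2 (Set.pair_subset ?_ ?_) hz <;> rw [SetLike.mem_coe, hu, hA] <;>
        exact subset_span (by simp)
    · intro hz
      have := FiniteDimensional.span_of_finite ℂ (Set.toFinite {u x, u y})
      obtain ⟨B, hB⟩ := hφ (projOp (span ℂ {u x, u y}))
      have hBspan : rootRange (φ B) = span ℂ {u x, u y} := by rw [hB, rootRange_projOp]
      rw [← hBspan, hu]
      refine span_le.2 (Set.pair_subset ?_ ?_) hz <;> rw [SetLike.mem_coe, ← hu, hBspan] <;>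
        exact subset_span (by simp)
  exists_span_eq w := by
    obtain ⟨B, hB⟩ := hφ (projOp (ℂ ∙ w))
    have hBw : rootRange (φ B) = ℂ ∙ w := by rw [hB, rootRange_projOp]
    obtain ⟨x, hx⟩ := (exists_rootRange_eq_span_singleton_iff_map hφ h B).2 ⟨w, hBw⟩
    obtain ⟨C, hC⟩ := hφ (projOp (ℂ ∙ u x))
    have hCx : rootRange (φ C) = ℂ ∙ u x := by rw [hC, rootRange_projOp]
    refine ⟨x, le_antisymm ?_ ?_⟩
    · rw [span_singleton_le_iff_mem, ← hBw, hu, hx]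
      exact mem_span_singleton_self x
    · rw [← hBw, ← hCx, ← h, hx, span_singleton_le_iff_mem, ← hu, hCx]
      exact mem_span_singleton_self (u x)

theorem exists_isCollineation_of_rootRange_le_iff :
    ∃ u : H → K, IsCollineation ℂ ℂ u ∧ ∀ A x, u x ∈ rootRange (φ A) ↔ x ∈ rootRange A := by
  choose u hu using fun x => (exists_rootRange_eq_span_singleton_iff_map hφ h (projOp (ℂ ∙ x))).1
    ⟨x, rootRange_projOp _⟩
  have hmem : ∀ A x, u x ∈ rootRange (φ A) ↔ x ∈ rootRange A := fun A x => by
    rw [← span_singleton_le_iff_mem, ← hu, ← h, rootRange_projOp, span_singleton_le_iff_mem]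
  exact ⟨u, isCollineation_of_mem_rootRange_iff hφ h hmem, hmem⟩

theorem exists_semilinear_of_rootRange_le_iff (hH : ¬ FiniteDimensional ℂ H) :
    ∃ (σ : ℂ →+* ℂ) (T : H →ₛₗ[σ] K), Function.Bijective σ ∧ Function.Bijective T ∧
      ∀ A x, T x ∈ rootRange (φ A) ↔ x ∈ rootRange A := by
  obtain ⟨u, hu, hmem⟩ := exists_isCollineation_of_rootRange_le_iff hφ h
  obtain ⟨σ, T, hTu⟩ := hu.exists_semilinear (exists_notMem_span_pair hH)
  have hT := hu.of_span_eq hTu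
  obtain ⟨e, he⟩ := exists_notMem_span_pair hH 0 0
  obtain ⟨x, hx⟩ := exists_notMem_span_pair hH e e
  have hσ : Function.Surjective σ := hT.surjective_ringHom (by simpa using he) (by simpa using hx)
  refine ⟨σ, T, ⟨σ.injective, hσ⟩, ⟨hT.injective, hT.surjective hσ⟩, fun A x => ?_⟩
  rw [← hmem A x, ← span_singleton_le_iff_mem, hTu, span_singleton_le_iff_mem]

end PointMap

section Continuity

theorem continuous_of_ker_eq_range {𝕜 E F : Type*} [NontriviallyNormedField 𝕜]
    [NormedAddCommGroup E] [NormedSpace 𝕜 E] [CompleteSpace E] [NormedAddCommGroup F]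
    [NormedSpace 𝕜 F] [CompleteSpace F] [CompleteSpace 𝕜] {f : F →ₗ[𝕜] 𝕜} {S : E →L[𝕜] F}
    (h : f.ker = S.range) : Continuous f := by
  obtain rfl | hf := eq_or_ne f 0
  · exact continuous_const
  obtain ⟨x, hx⟩ := DFunLike.ne_iff.1 hf
  let q : E × 𝕜 →L[𝕜] F := S.coprod (ContinuousLinearMap.toSpanSingleton 𝕜 x)
  have hfq : ∀ p, f (q p) = p.2 * f x := fun p => by
    have hSp : f (S p.1) = 0 := h.ge ⟨p.1, rfl⟩
    simp [q, hSp]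
  have hq : Function.Surjective q := by
    intro y
    have hy : f (y - (f y / f x) • x) = 0 := by
      rw [map_sub, map_smul, smul_eq_mul, div_mul_cancel₀ _ hx, sub_self]
    obtain ⟨v, hv⟩ := h.le hy
    exact ⟨(v, f y / f x), (congrArg (· + (f y / f x) • x) hv).trans (sub_add_cancel _ _)⟩
  rw [((q.isOpenMap hq).isQuotientMap q.continuous hq).continuous_iff]
  exact (continuous_snd.mul continuous_const).congr fun p => (hfq p).symm

section Orthonormal

variable {𝕜 E : Type*} [RCLike 𝕜] [NormedAddCommGroup E] [InnerProductSpace 𝕜 E]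

theorem exists_orthonormal_nat (hE : ¬ FiniteDimensional 𝕜 E) :
    ∃ e : ℕ → E, Orthonormal 𝕜 e := by
  let b := Module.Basis.ofVectorSpace 𝕜 E
  have : Infinite (Module.Basis.ofVectorSpaceIndex 𝕜 E) :=
    not_finite_iff_infinite.1 fun _ => hE b.finiteDimensional_of_finite
  let i := Infinite.natEmbedding (Module.Basis.ofVectorSpaceIndex 𝕜 E)
  exact ⟨_, InnerProductSpace.gramSchmidtNormed_orthonormal
    (b.linearIndependent.comp i i.injective)⟩

theorem exists_inner_eq_of_orthonormal [CompleteSpace E] {ι : Type*} {e : ι → E}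
    (he : Orthonormal 𝕜 e) {a : ι → 𝕜} (ha : Summable fun n => ‖a n‖) :
    ∃ y : E, ∀ n, inner 𝕜 y (e n) = a n := by
  have hsum : Summable fun n => conj (a n) • e n :=
    ha.of_norm_bounded fun n => by simp [norm_smul, he.1 n]
  refine ⟨∑' n, conj (a n) • e n, fun n => ?_⟩
  have hinner := (hsum.hasSum.mapL (innerSL 𝕜 (e n))).unique <|
    hasSum_single n fun m hm => by simp [he.2 hm.symm]
  simp only [innerSL_apply_apply, inner_smul_right, inner_self_eq_norm_sq_to_K, he.1 n] at hinner
  rw [← inner_conj_symm, hinner]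
  simp

end Orthonormal

/-- Otherwise, along an orthonormal sequence `T (x n)`, there would be a summable sequence `a n`
with `τ (a n)` growing faster than `n * ‖x n‖`, and a vector `y` with `⟪y, T (x n)⟫ = a n`. -/
theorem addMonoidHom_continuous_of_bound_inner {𝕜 E F G : Type*} [RCLike 𝕜]
    [SeminormedAddCommGroup E] [NormedAddCommGroup F] [InnerProductSpace 𝕜 F] [CompleteSpace F]
    [SeminormedAddCommGroup G] [NormedSpace ℝ G] (hF : ¬ FiniteDimensional 𝕜 F) (τ : 𝕜 →+ G)
    {T : E → F} (hT : Function.Surjective T)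
    (h : ∀ y, ∃ C : ℝ, ∀ x, ‖τ (inner 𝕜 y (T x))‖ ≤ C * ‖x‖) : Continuous τ := by
  by_contra hτ
  have hunbounded : ∀ δ M : ℝ, 0 < δ → ∃ a : 𝕜, ‖a‖ ≤ δ ∧ M < ‖τ a‖ := by
    intro δ M hδ
    by_contra! hbound
    refine hτ (τ.continuous_of_isBounded_nhds_zero (Metric.closedBall_mem_nhds 0 hδ) ?_)
    refine isBounded_iff_forall_norm_le.2 ⟨M, ?_⟩
    rintro _ ⟨a, ha, rfl⟩
    exact hbound a (by simpa using ha)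
  obtain ⟨e, he⟩ := exists_orthonormal_nat hF
  choose x hx using fun n => hT (e n)
  choose a ha hτa using fun n : ℕ => hunbounded ((1 / 2) ^ n) (n * ‖x n‖) (by positivity)
  obtain ⟨y, hy⟩ := exists_inner_eq_of_orthonormal he <|
    summable_geometric_two.of_nonneg_of_le (fun n => norm_nonneg (a n)) ha
  obtain ⟨C, hC⟩ := h y
  obtain ⟨n, hn⟩ := exists_nat_ge C
  have hbound : ‖τ (a n)‖ ≤ n * ‖x n‖ := by
    rw [← hy, ← hx]
    exact (hC (x n)).trans (by gcongr)
  exact (hτa n).not_ge hbound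

theorem linearMap_continuous_of_continuous_inner {𝕜 E F : Type*} [RCLike 𝕜] [NormedAddCommGroup E]
    [NormedSpace ℝ E] [CompleteSpace E] [NormedAddCommGroup F] [InnerProductSpace 𝕜 F]
    [NormedSpace ℝ F] [CompleteSpace F] {T : E →ₗ[ℝ] F}
    (h : ∀ y, Continuous fun x => inner 𝕜 y (T x)) : Continuous T :=
  T.continuous_of_seq_closed_graph fun _ v _ hu hTu => ext_inner_left 𝕜 fun y =>
    tendsto_nhds_unique (tendsto_const_nhds.inner hTu) (((h y).tendsto v).comp hu)

theorem ringHom_eq_id_or_conj_of_rightInverse {σ τ : ℂ →+* ℂ} (hτ : Continuous τ)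
    (hστ : ∀ c, σ (τ c) = c) : σ = RingHom.id ℂ ∨ σ = conj := by
  refine (Complex.ringHom_eq_id_or_conj_of_continuous hτ).imp ?_ ?_ <;> rintro rfl <;> ext c
  · exact hστ c
  · simpa using hστ (conj c)

variable {H K : Type*} [NormedAddCommGroup H] [InnerProductSpace ℂ H] [CompleteSpace H]
  [NormedAddCommGroup K] [InnerProductSpace ℂ K] [CompleteSpace K]
  {φ : PosOp H → PosOp K} (hφ : Function.Surjective φ)
include hφ

section Semilinear

variable {σ τ : ℂ →+* ℂ} (hστ : ∀ c, σ (τ c) = c) (hτσ : ∀ c, τ (σ c) = c) {T : H →ₛₗ[σ] K}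
  (hT : ∀ A x, T x ∈ rootRange (φ A) ↔ x ∈ rootRange A)
include hτσ hT

/-- The kernel of the linear functional `x ↦ τ ⟪y, T x⟫` is the preimage of `{y}ᗮ` under `T`, hence
a root range. -/
theorem exists_continuousLinearMap_eq_inner_semilinear (y : K) :
    ∃ f : H →L[ℂ] ℂ, ∀ x, f x = τ ⟪y, T x⟫_ℂ := by
  let f : H →ₗ[ℂ] ℂ :=
    { toFun := fun x => τ ⟪y, T x⟫_ℂ
      map_add' := fun _ _ => by rw [map_add, inner_add_right, map_add]
      map_smul' := fun c _ => by
        rw [map_smulₛₗ, inner_smul_right, map_mul, hτσ, RingHom.id_apply, smul_eq_mul] }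
  obtain ⟨B, hB⟩ := hφ (projOp (ℂ ∙ y)ᗮ)
  refine ⟨⟨f, continuous_of_ker_eq_range (S := opSqrt B.1) <| Submodule.ext fun x => ?_⟩,
    fun _ => rfl⟩
  have hx := hT B x
  rw [hB, rootRange_projOp, Submodule.mem_orthogonal_singleton_iff_inner_right] at hx
  exact (map_eq_zero_iff τ τ.injective).trans hx

include hστ

theorem eq_id_or_conj_of_mem_rootRange_iff (hK : ¬ FiniteDimensional ℂ K)
    (hTsurj : Function.Surjective T) : σ = RingHom.id ℂ ∨ σ = conj := by
  have hτ : Continuous τ.toAddMonoidHom := by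
    refine addMonoidHom_continuous_of_bound_inner hK _ hTsurj fun y => ?_
    obtain ⟨f, hf⟩ := exists_continuousLinearMap_eq_inner_semilinear hφ hτσ hT y
    exact ⟨‖f‖, fun x => (congrArg norm (hf x)).ge.trans (f.le_opNorm x)⟩
  exact ringHom_eq_id_or_conj_of_rightInverse hτ hστ

theorem continuous_of_mem_rootRange_iff (hσ : σ = RingHom.id ℂ ∨ σ = conj) : Continuous T := by
  have hσ_cont : Continuous σ := by
    rcases hσ with rfl | rfl
    exacts [continuous_id, Complex.continuous_conj]
  have hσ_real : ∀ c : ℝ, σ c = c := by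
    rcases hσ with rfl | rfl
    exacts [fun _ => rfl, Complex.conj_ofReal]
  let TReal : H →ₗ[ℝ] K :=
    { T with
      map_smul' := fun c x => (map_smulₛₗ T (c : ℂ) x).trans (by rw [hσ_real]; rfl) }
  refine linearMap_continuous_of_continuous_inner (𝕜 := ℂ) (T := TReal) fun y => ?_
  obtain ⟨f, hf⟩ := exists_continuousLinearMap_eq_inner_semilinear hφ hτσ hT y
  refine (hσ_cont.comp f.continuous).congr fun x => ?_
  rw [Function.comp_apply, hf, hστ]
  rfl

end Semilinear

theorem exists_continuousLinearEquiv_of_rootRange_le_iff (hH : ¬ FiniteDimensional ℂ H)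
    (h : ∀ A B, rootRange A ≤ rootRange B ↔ rootRange (φ A) ≤ rootRange (φ B)) :
    (∃ T : H ≃L[ℂ] K, ∀ A, (rootRange (φ A) : Set K) = T '' rootRange A) ∨
      ∃ T : H ≃L⋆[ℂ] K, ∀ A, (rootRange (φ A) : Set K) = T '' rootRange A := by
  obtain ⟨σ, T, hσ, hT, hmem⟩ := exists_semilinear_of_rootRange_le_iff hφ h hH
  have himage : ∀ A, (rootRange (φ A) : Set K) = T '' rootRange A := fun A => by
    rw [← Set.image_preimage_eq (rootRange (φ A) : Set K) hT.2]
    exact congrArg (T '' ·) (Set.ext (hmem A))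
  let e := RingEquiv.ofBijective σ hσ
  let τ : ℂ →+* ℂ := e.symm
  have hστ : ∀ c, σ (τ c) = c := e.apply_symm_apply
  have hτσ : ∀ c, τ (σ c) = c := e.symm_apply_apply
  have hK : ¬ FiniteDimensional ℂ K := fun _ => by
    have : RingHomInvPair σ τ := ⟨RingHom.ext hτσ, RingHom.ext hστ⟩
    have : RingHomInvPair τ σ := ⟨RingHom.ext hστ, RingHom.ext hτσ⟩
    let Tinv : K →ₛₗ[τ] H := (LinearEquiv.ofBijective T hT).symm
    exact hH (Module.Finite.of_surjective Tinv (LinearEquiv.ofBijective T hT).symm.surjective)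
  have hσ' := eq_id_or_conj_of_mem_rootRange_iff hφ hστ hτσ hmem hK hT.2
  have hcont := continuous_of_mem_rootRange_iff hφ hστ hτσ hmem hσ'
  clear_value τ
  clear e
  rcases hσ' with rfl | rfl
  · exact .inl ⟨(LinearEquiv.ofBijective T hT).toContinuousLinearEquivOfContinuous hcont, himage⟩
  · exact .inr ⟨(LinearEquiv.ofBijective T hT).toContinuousLinearEquivOfContinuous hcont, himage⟩

end Continuity

section ImageInvariance

variable {H K : Type*} [NormedAddCommGroup H] [InnerProductSpace ℂ H] [CompleteSpace H]
  [NormedAddCommGroup K] [InnerProductSpace ℂ K] [CompleteSpace K]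

theorem range_opSqrt_eq_iff {T : H → K} {A : PosOp H} {B : PosOp K} :
    Set.range (opSqrt B.1) = Set.range (fun x => T (opSqrt A.1 x)) ↔
      (rootRange B : Set K) = T '' rootRange A :=
  Eq.congr_right (Set.range_comp T (opSqrt A.1))

variable {𝓕 : Type*} [FunLike 𝓕 H K] [AddMonoidHomClass 𝓕 H K] {T : 𝓕}
  (hT : Function.Injective T) {A B : PosOp H} {A' B' : PosOp K}
  (hA : (rootRange A' : Set K) = T '' rootRange A) (hB : (rootRange B' : Set K) = T '' rootRange B)
include hT hA hB

theorem singular_iff_of_rootRange_eq_image : Singular A B ↔ Singular A' B' := by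
  simp only [singular_iff_disjoint, Submodule.disjoint_def, ← SetLike.mem_coe (p := rootRange A'),
    ← SetLike.mem_coe (p := rootRange B'), hA, hB, Set.forall_mem_image, hT.mem_set_image,
    SetLike.mem_coe, map_eq_zero_iff T hT]

/-- Density of a preimage under `opSqrt A'` depends only on the range of `opSqrt A'`, which is also
that of `T ∘ opSqrt A`; additivity makes `T` real linear, whether it is complex linear or
conjugate-linear. -/
theorem absCont_iff_of_rootRange_eq_image (hTcont : Continuous T) :
    AbsCont A B ↔ AbsCont A' B' := by
  let TReal : H →L[ℝ] K := (T : H →+ K).toRealLinearMap hTcont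
  have hrange : ((opSqrt A'.1).restrictScalars ℝ).range =
      (TReal ∘L (opSqrt A.1).restrictScalars ℝ).range :=
    SetLike.coe_injective (range_opSqrt_eq_iff.2 hA)
  have hpre : opSqrt A.1 ⁻¹' rootRange B =
      (TReal ∘L (opSqrt A.1).restrictScalars ℝ) ⁻¹' rootRange B' := by
    rw [hB]
    exact Set.ext fun x => (hT.mem_set_image (a := opSqrt A.1 x)).symm
  rw [absCont_iff_dense_preimage, absCont_iff_dense_preimage, hpre,
    ← dense_preimage_iff_of_range_eq hrange]
  rfl

end ImageInvariance

section Representation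

variable {H : Type*} [NormedAddCommGroup H] [InnerProductSpace ℂ H] [CompleteSpace H]
  {φ : PosOp H → PosOp H}

theorem forall_rootRange_eq_iff_exists_isUnit {ψ : PosOp H → PosOp H} :
    (∀ A, rootRange (φ A) = rootRange (ψ A)) ↔ ∃ Z : PosOp H → PosOp H, ∀ A, IsUnit (Z A).1 ∧
      (φ A).1 = opSqrt (ψ A).1 ∘L (Z A).1 ∘L opSqrt (ψ A).1 := by
  constructor
  · intro h
    choose Z hZ using fun A => exists_isUnit_of_rootRange_eq (h A)
    exact ⟨Z, hZ⟩
  · rintro ⟨Z, hZ⟩ A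
    exact rootRange_eq_of_isUnit (hZ A).1 (hZ A).2

theorem rootRange_eq_image_iff_exists_isUnit {T : H → H} {ψ : PosOp H → PosOp H}
    (hψ : ∀ A, (rootRange (ψ A) : Set H) = T '' rootRange A) :
    (∀ A, (rootRange (φ A) : Set H) = T '' rootRange A) ↔
      ∃ Z : PosOp H → PosOp H, ∀ A, IsUnit (Z A).1 ∧
        (φ A).1 = opSqrt (ψ A).1 ∘L (Z A).1 ∘L opSqrt (ψ A).1 := by
  simp only [← hψ, SetLike.coe_set_eq, forall_rootRange_eq_iff_exists_isUnit]

end Representation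

end

theorem theorem3p1_general {H : Type*} [NormedAddCommGroup H] [InnerProductSpace ℂ H]
    [CompleteSpace H] (hH : ¬ FiniteDimensional ℂ H) (φ : PosOp H → PosOp H)
    (hφ : Function.Surjective φ) :
    List.TFAE [
      ∀ A B : PosOp H, AbsCont A B ↔ AbsCont (φ A) (φ B),
      ∀ A B : PosOp H, Singular A B ↔ Singular (φ A) (φ B),
      (∃ T : H ≃L[ℂ] H, ∀ A : PosOp H,
          Set.range (opSqrt (φ A).1) = Set.range (fun x => T (opSqrt A.1 x))) ∨
        (∃ T : H ≃L⋆[ℂ] H, ∀ A : PosOp H,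
          Set.range (opSqrt (φ A).1) = Set.range (fun x => T (opSqrt A.1 x))),
      (∃ (T : H ≃L[ℂ] H) (Z : PosOp H → PosOp H), ∀ A : PosOp H, IsUnit (Z A).1 ∧
          (φ A).1 = opSqrt (conjugateLin (T : H →L[ℂ] H) A.1) ∘L (Z A).1 ∘L
            opSqrt (conjugateLin (T : H →L[ℂ] H) A.1)) ∨
        (∃ (T : H ≃L⋆[ℂ] H) (Z : PosOp H → PosOp H), ∀ A : PosOp H, IsUnit (Z A).1 ∧
          (φ A).1 = opSqrt (conjugateConj (T : H →L⋆[ℂ] H) A.1) ∘L (Z A).1 ∘L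
            opSqrt (conjugateConj (T : H →L⋆[ℂ] H) A.1))] := by
  simp only [range_opSqrt_eq_iff]
  tfae_have 1 → 3 := fun h => exists_continuousLinearEquiv_of_rootRange_le_iff hφ hH
    (isWeakInclusion_absCont.rootRange_le_iff_map isWeakInclusion_absCont hφ h)
  tfae_have 2 → 3 := fun h => exists_continuousLinearEquiv_of_rootRange_le_iff hφ hH
    (rootRange_le_iff_map_of_singular hφ h)
  tfae_have 3 → 1 := by
    rintro (⟨T, hT⟩ | ⟨T, hT⟩) A B <;>
      exact absCont_iff_of_rootRange_eq_image T.injective (hT A) (hT B) T.continuous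
  tfae_have 3 → 2 := by
    rintro (⟨T, hT⟩ | ⟨T, hT⟩) A B <;>
      exact singular_iff_of_rootRange_eq_image T.injective (hT A) (hT B)
  tfae_have 3 ↔ 4 := or_congr
    (exists_congr fun T => rootRange_eq_image_iff_exists_isUnit <|
      coe_rootRange_conjugateLinPos (T : H →L[ℂ] H))
    (exists_congr fun T => rootRange_eq_image_iff_exists_isUnit <| coe_rootRange_conjugateConjPos T)
  tfae_finish

theorem theorem3p1 {H : Type*} [NormedAddCommGroup H] [InnerProductSpace ℂ H] [CompleteSpace H]
    (hH : ¬ FiniteDimensional ℂ H) (φ : PosOp H → PosOp H) (hφ : Function.Bijective φ) :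
    List.TFAE [
      -- (i) absolute continuity is preserved in both directions
      ∀ A B : PosOp H, AbsCont A B ↔ AbsCont (φ A) (φ B),
      -- (ii) singularity is preserved in both directions
      ∀ A B : PosOp H, Singular A B ↔ Singular (φ A) (φ B),
      -- (iii) `T` is bounded, invertible, and linear or conjugate-linear
      (∃ T : H ≃L[ℂ] H, ∀ A : PosOp H,
          Set.range (opSqrt (φ A).1) = Set.range (fun x => T (opSqrt A.1 x))) ∨
        (∃ T : H ≃L⋆[ℂ] H, ∀ A : PosOp H,
          Set.range (opSqrt (φ A).1) = Set.range (fun x => T (opSqrt A.1 x))),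
      -- (iv) the same kind of `T`, and a family `Z` of invertible positive operators
      (∃ (T : H ≃L[ℂ] H) (Z : PosOp H → PosOp H), ∀ A : PosOp H, IsUnit (Z A).1 ∧
          (φ A).1 = opSqrt (conjugateLin (T : H →L[ℂ] H) A.1) ∘L (Z A).1 ∘L
            opSqrt (conjugateLin (T : H →L[ℂ] H) A.1)) ∨
        (∃ (T : H ≃L⋆[ℂ] H) (Z : PosOp H → PosOp H), ∀ A : PosOp H, IsUnit (Z A).1 ∧
          (φ A).1 = opSqrt (conjugateConj (T : H →L⋆[ℂ] H) A.1) ∘L (Z A).1 ∘L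
            opSqrt (conjugateConj (T : H →L⋆[ℂ] H) A.1))] :=
  theorem3p1_general hH φ hφ.2
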